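/- Let $n\ge 2$. For $x\in\mathbf R$ let $p(x)$ be the unique integer $k$ with $k-\frac12<x\le k+\frac12$, and let $\pi(x_1,\dots,x_n)=(p(x_1),\dots,p(x_n))$. The discretization of a matrix $P\in O_n(\mathbf R)$ is the map $\widehat P:\mathbf Z^n\to\mathbf Z^n$, $\widehat P(x)=\pi(Px)$. For a sequence $(P_k)_{k\ge1}$ in $O_n(\mathbf R)$ put $$\tau^k(P_1,\dots,P_k)=\limsup_{R\to+\infty}\frac{\operatorname{Card}\big((\widehat{P_k}\circ\cdots\circ\widehat{P_1})(\mathbf Z^n)\cap[B_R]\big)}{\operatorname{Card}[B_R]},\qquad \tau^\infty\big((P_k)_k\big)=\lim_{k\to+\infty}\tau^k(P_1,\dots,P_k),$$ where $[B_R]=\{x\in\mathbf Z^n : |x_i|<R \text{ for all } i\}$. Let $\ell^\infty(O_n(\mathbf R))$ be the space of all sequences $(P_k)_{k\ge1}$ in $O_n(\mathbf R)$ with the distance $\sup_{k\ge1}\|P_k-Q_k\|$, where $\|\cdot\|$ is a norm on $M_n(\mathbf R)$ (the topology does not depend on its choice). There is a dense $G_\delta$ subset of $\ell^\infty(O_n(\mathbf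 R))$ such that, for every sequence $(P_k)_k$ in it, the limit $\tau^\infty((P_k)_k)$ exists and equals $0$. Moreover, for every $\varepsilon>0$ there is an open dense subset of $\ell^\infty(O_n(\mathbf R))$ such that, for every sequence $(P_k)_k$ in it, the limit $\tau^\infty((P_k)_k)$ exists and is smaller than $\varepsilon$. -/

import Mathlib

open Filter Topology

namespace DiscreteIsometry

/-- `p x` is the unique integer `k` with `k - 1/2 < x ≤ k + 1/2`
(so ties are rounded down, unlike Mathlib's `round`). -/
noncomputable def p (x : ℝ) : ℤ := ⌈x - 1 / 2⌉

theorem p_eq_iff (x : ℝ) (k : ℤ) : p x = k ↔ (k : ℝ) - 1 / 2 < x ∧ x ≤ k + 1 / 2 := by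
  rw [p, Int.ceil_eq_iff]
  constructor <;> rintro ⟨h, h'⟩ <;> constructor <;> linarith

/-- Coordinatewise projection `ℝⁿ → ℤⁿ`. -/
noncomputable def proj {n : ℕ} (x : Fin n → ℝ) : Fin n → ℤ := fun i => p (x i)

/-- The discretization `x ↦ π (P x)` of a matrix `P`, as a map `ℤⁿ → ℤⁿ`. -/
noncomputable def disc {n : ℕ} (P : Matrix (Fin n) (Fin n) ℝ) (x : Fin n → ℤ) : Fin n → ℤ :=
  proj (P.mulVec fun i => (x i : ℝ))

/-- Sequences of elements of `O_n(ℝ)`. The term of index `k : ℕ` plays the role of `P_{k+1}`. -/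
def OrthSeq (n : ℕ) : Type := ℕ → Matrix.orthogonalGroup (Fin n) ℝ

section Metric

/- The norm on `n × n` matrices is the largest absolute value of an entry. -/
attribute [local instance] Matrix.normedAddCommGroup

theorem norm_orthogonal_le {n : ℕ} (A : Matrix.orthogonalGroup (Fin n) ℝ) :
    ‖(A : Matrix (Fin n) (Fin n) ℝ)‖ ≤ 1 :=
  entrywise_sup_norm_bound_of_unitary A.2

theorem bddAbove_dist {n : ℕ} (P Q : OrthSeq n) :
    BddAbove (Set.range fun k => ‖(P k : Matrix (Fin n) (Fin n) ℝ) - Q k‖) := by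
  refine ⟨1 + 1, ?_⟩
  rintro _ ⟨k, rfl⟩
  exact (norm_sub_le _ _).trans (add_le_add (norm_orthogonal_le _) (norm_orthogonal_le _))

/-- The space `ℓ^∞(O_n(ℝ))`: all sequences in `O_n(ℝ)`, with the distance
`sup_k ‖P_k - Q_k‖`. -/
noncomputable instance instMetricSpaceOrthSeq (n : ℕ) : MetricSpace (OrthSeq n) where
  dist P Q := ⨆ k, ‖(P k : Matrix (Fin n) (Fin n) ℝ) - Q k‖
  dist_self P := by simp
  dist_comm P Q := by simp only [norm_sub_rev]
  dist_triangle P Q R := by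
    refine ciSup_le fun k => ?_
    exact (norm_sub_le_norm_sub_add_norm_sub _ _ _).trans
      (add_le_add (le_ciSup (bddAbove_dist P Q) k) (le_ciSup (bddAbove_dist Q R) k))
  eq_of_dist_eq_zero := by
    intro P Q h
    funext k
    have h1 : ‖(P k : Matrix (Fin n) (Fin n) ℝ) - Q k‖ ≤ 0 :=
      (le_ciSup (bddAbove_dist P Q) k).trans h.le
    exact Subtype.ext (sub_eq_zero.mp (norm_le_zero_iff.mp h1))

end Metric

/-- The composition of the discretizations of the first `k` matrices of the sequence,
the first matrix being applied first. -/
noncomputable def iter {n : ℕ} (P : OrthSeq n) : ℕ → (Fin n → ℤ) → (Fin n → ℤ)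
  | 0 => id
  | k + 1 => disc (P k : Matrix (Fin n) (Fin n) ℝ) ∘ iter P k

/-- The integer points of the open ball of radius `R` centred at `0` for the sup norm. -/
def intBall (n : ℕ) (R : ℝ) : Set (Fin n → ℤ) := {x | ∀ i, |(x i : ℝ)| < R}

/-- The upper density of a subset of `ℤⁿ` (as the radius `R : ℝ` tends to infinity). -/
noncomputable def upperDensity {n : ℕ} (Γ : Set (Fin n → ℤ)) : ℝ :=
  limsup (fun R : ℝ => ((Γ ∩ intBall n R).ncard : ℝ) / ((intBall n R).ncard : ℝ)) atTop

/-- The rate of injectivity in time `k`. -/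
noncomputable def rate {n : ℕ} (P : OrthSeq n) (k : ℕ) : ℝ :=
  upperDensity (Set.range (iter P k))

/-- The asymptotic rate of injectivity of `P` (the limit of the rates in time `k`) exists and
is equal to `t`. -/
def HasAsymptoticRate {n : ℕ} (P : OrthSeq n) (t : ℝ) : Prop :=
  Tendsto (fun k => rate P k) atTop (𝓝 t)

end DiscreteIsometry

/-! # Discretizations of generic sequences of isometries

A set `gam Q θ k` is the image of `ℤⁿ` under `k` successive discretized affine isometries
`x ↦ Q j x + θ j`; the sets of the theorem are those with `θ = 0`, but other translation parts
appear as soon as one looks at these sets around a point other than the origin.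

*Existence of the limit, for all sequences.* These sets are almost periodic in the sense of Weyl
(`almostPer_gam`): if `a` is an almost period of `Γ` and `A a` is close to an integer vector `b`,
then `b` is an almost period of the discretized image of `Γ` under `A`, since only the points whose
image is close to a tie are affected, and these are rare. An almost periodic set has a density
which is uniform with respect to the position of the cubes (`AlmostPer.exists_uDens`), so that
Euclidean balls, which are preserved by isometries, may be used instead of cubes; this shows that
the rate is nonincreasing in time (`rate_antitone`).

*Generic sequences.* Two dense `Gδ` conditions are imposed (`genericSet`). One of them, with
Kronecker's theorem, implies that the vectors `(Q₀ x, Q₁ Q₀ x, …)`, for `x` in `ℤⁿ`, are dense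
modulo `1`; hence all the sets `gam Q θ k` have the same local patterns, whatever `θ`
(`exists_cnt_eq_cnt_zero`), and the same density, uniformly in `θ`. The other one is that the
coordinates of `Q j u`, for nonzero integer vectors `u` of bounded size, stay away from the
integers uniformly in `j`. It implies that for sequences close to `Q`, the local patterns
are among those of `Q` for suitable `θ` (`exists_gam_eq_of_near`), hence that the rate in time `k`
is upper semicontinuous at `Q` (`exists_rate_lt_of_near`).

*Decrease of the rate.* If `gam Q 0 k` has density at least `ε`, then a positive proportion of its
points `x` have a neighbour `x + u` in it, for some `u ≠ 0` of bounded size. As the density does not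
depend on `θ`, the next translation parts may be chosen freely. By the pigeonhole principle, they
can be chosen so that for a positive proportion of pairs, the difference is successively replaced by
its image under `Q j` truncated towards `0`. Its Euclidean norm decreases strictly, so that after a
bounded number of steps the pairs are merged (`exists_merge`). Hence the density drops by a
definite amount (`exists_rate_add_le`), and the rate tends to `0` for generic sequences. The open
sets of the second part are neighbourhoods of the generic sequences.
-/

namespace DiscreteIsometry

variable {n : ℕ}

/-! ### Counting points of a subset of `ℤⁿ` -/

/-- An integer vector, seen as a real vector. -/
def castVec (x : Fin n → ℤ) : Fin n → ℝ := fun i => (x i : ℝ)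

@[simp] theorem castVec_apply (x : Fin n → ℤ) (i : Fin n) : castVec x i = x i := rfl

theorem castVec_add (x y : Fin n → ℤ) : castVec (x + y) = castVec x + castVec y := by
  ext i; simp

theorem castVec_sub (x y : Fin n → ℤ) : castVec (x - y) = castVec x - castVec y := by
  ext i; simp

/-- The integer points of the half-open cube with lower corner `z` and side `L`. -/
noncomputable def box (z : Fin n → ℤ) (L : ℕ) : Finset (Fin n → ℤ) :=
  Fintype.piFinset fun i => Finset.Ico (z i) (z i + L)

theorem mem_box {z x : Fin n → ℤ} {L : ℕ} : x ∈ box z L ↔ ∀ i, z i ≤ x i ∧ x i < z i + L := by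
  simp [box]

theorem card_box (z : Fin n → ℤ) (L : ℕ) : (box z L).card = L ^ n := by
  simp [box]

open Classical in
/-- The number of elements of `Γ` in the finite set `A`. -/
noncomputable def cnt (Γ : Set (Fin n → ℤ)) (A : Finset (Fin n → ℤ)) : ℕ :=
  (A.filter (· ∈ Γ)).card

theorem cnt_le_card (Γ : Set (Fin n → ℤ)) (A : Finset (Fin n → ℤ)) : cnt Γ A ≤ A.card :=
  by classical exact Finset.card_filter_le _ _

theorem cnt_eq_zero {Γ : Set (Fin n → ℤ)} {A : Finset (Fin n → ℤ)} (h : ∀ x ∈ A, x ∉ Γ) :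
    cnt Γ A = 0 := by
  classical
  rw [cnt, Finset.card_eq_zero, Finset.filter_eq_empty_iff]
  exact fun x hx => h x hx

theorem cnt_mono (Γ : Set (Fin n → ℤ)) {A B : Finset (Fin n → ℤ)} (h : A ⊆ B) :
    cnt Γ A ≤ cnt Γ B :=
  by classical exact Finset.card_le_card (Finset.filter_subset_filter _ h)

theorem cnt_add_cnt_compl (Γ : Set (Fin n → ℤ)) (A : Finset (Fin n → ℤ)) :
    cnt Γ A + cnt Γᶜ A = A.card := by
  classical
  have := Finset.card_filter_add_card_filter_not (s := A) (fun x => x ∈ Γ)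
  simpa [cnt] using this

theorem cnt_union_le (Γ Γ' : Set (Fin n → ℤ)) (A : Finset (Fin n → ℤ)) :
    cnt (Γ ∪ Γ') A ≤ cnt Γ A + cnt Γ' A := by
  classical
  simp only [cnt, Set.mem_union, Finset.filter_or]
  exact Finset.card_union_le _ _

theorem cnt_le_cnt_add_card_sub (Γ : Set (Fin n → ℤ)) {A B : Finset (Fin n → ℤ)} (h : A ⊆ B) :
    cnt Γ B + A.card ≤ cnt Γ A + B.card := by
  have h1 := cnt_add_cnt_compl Γ A
  have h2 := cnt_add_cnt_compl Γ B
  have h3 := cnt_mono Γᶜ h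
  omega

/-- If the elements of `Γ` in `A` are images under `g` of elements of `Γ'` in `B`, then there are
at most as many of them. -/
theorem cnt_le_cnt_of_surj {Γ Γ' : Set (Fin n → ℤ)} {A B : Finset (Fin n → ℤ)}
    (g : (Fin n → ℤ) → (Fin n → ℤ)) (h : ∀ y ∈ A, y ∈ Γ → ∃ x ∈ B, x ∈ Γ' ∧ g x = y) :
    cnt Γ A ≤ cnt Γ' B := by
  classical
  refine Finset.card_le_card_of_surjOn g ?_
  intro y hy
  simp only [Finset.coe_filter, Set.mem_ofPred_eq] at hy
  obtain ⟨x, hx, hx', rfl⟩ := h y hy.1 hy.2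
  exact ⟨x, by simp [hx, hx'], rfl⟩

/-- Double counting: a bound for the number of elements of `Γ` in all cubes of side `L` bounds
the number of elements of `Γ` in any finite set `A`, up to a thickening `B` of `A`. -/
theorem cnt_le_of_box {Γ : Set (Fin n → ℤ)} {L : ℕ} (hL : 0 < L) {s : ℝ}
    (h : ∀ z, (cnt Γ (box z L) : ℝ) ≤ s * L ^ n) {A B : Finset (Fin n → ℤ)}
    (hAB : ∀ x ∈ A, box (fun i => x i - L + 1) L ⊆ B) :
    (cnt Γ A : ℝ) ≤ s * B.card := by
  classical
  have key : cnt Γ A * L ^ n ≤ ∑ z ∈ B, cnt Γ (box z L) := by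
    calc cnt Γ A * L ^ n = ∑ x ∈ A.filter (· ∈ Γ), L ^ n := by simp [cnt]
      _ ≤ ∑ x ∈ A.filter (· ∈ Γ), (B.bipartiteAbove (fun x z => x ∈ box z L) x).card := by
        refine Finset.sum_le_sum fun x hx => ?_
        rw [← card_box (fun i => x i - L + 1) L]
        refine Finset.card_le_card fun z hz => ?_
        rw [Finset.mem_bipartiteAbove]
        refine ⟨hAB x (Finset.mem_filter.mp hx).1 hz, ?_⟩
        rw [mem_box] at hz ⊢
        intro i
        have := hz i
        omega
      _ = ∑ z ∈ B, ((A.filter (· ∈ Γ)).bipartiteBelow (fun x z => x ∈ box z L) z).card :=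
        Finset.sum_card_bipartiteAbove_eq_sum_card_bipartiteBelow _
      _ ≤ ∑ z ∈ B, cnt Γ (box z L) := by
        refine Finset.sum_le_sum fun z _ => Finset.card_le_card fun x hx => ?_
        simp only [Finset.mem_bipartiteBelow, Finset.mem_filter] at hx ⊢
        exact ⟨hx.2, hx.1.2⟩
  have hLn : (0 : ℝ) < (L : ℝ) ^ n := by positivity
  have key' : (cnt Γ A : ℝ) * L ^ n ≤ (s * B.card) * L ^ n := by
    calc (cnt Γ A : ℝ) * L ^ n ≤ ∑ z ∈ B, (cnt Γ (box z L) : ℝ) := by exact_mod_cast key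
      _ ≤ ∑ z ∈ B, s * (L : ℝ) ^ n := Finset.sum_le_sum fun z _ => h z
      _ = (s * B.card) * L ^ n := by simp; ring
  exact le_of_mul_le_mul_right key' hLn

theorem cnt_box_le_of_box {Γ : Set (Fin n → ℤ)} {L : ℕ} (hL : 0 < L) {s : ℝ}
    (h : ∀ z, (cnt Γ (box z L) : ℝ) ≤ s * L ^ n) (z : Fin n → ℤ) (L' : ℕ) :
    (cnt Γ (box z L') : ℝ) ≤ s * (L' + L : ℝ) ^ n := by
  have := cnt_le_of_box hL h (A := box z L') (B := box (fun i => z i - L) (L' + L)) ?_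
  · rw [card_box] at this
    exact_mod_cast this
  · intro x hx y hy
    rw [mem_box] at *
    intro i
    have := hx i
    have := hy i
    push_cast
    omega

/-! ### Uniform density and almost periodic sets -/

/-- `Γ` has uniform density `D`: the proportion of elements of `Γ` in a cube of side `L` tends to
`D` as `L → ∞`, uniformly with respect to the position of the cube. -/
def UDens (Γ : Set (Fin n → ℤ)) (D : ℝ) : Prop :=
  ∀ η > 0, ∃ L₀ : ℕ, ∀ L ≥ L₀, ∀ z, |(cnt Γ (box z L) : ℝ) - D * L ^ n| ≤ η * L ^ n

/-- `E` has at most a proportion `ε` of points in each cube of side at least `L₀`. -/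
def Sparse (E : Set (Fin n → ℤ)) (ε : ℝ) (L₀ : ℕ) : Prop :=
  ∀ L ≥ L₀, ∀ z, (cnt E (box z L) : ℝ) ≤ ε * L ^ n

/-- A form of almost periodicity: for each `ε`, there is a colouring of `ℤⁿ` by finitely many
colours such that translating `Γ` by a difference of two vectors of the same colour only affects
a proportion at most `ε` of points, uniformly over large cubes. -/
def AlmostPer (Γ : Set (Fin n → ℤ)) : Prop :=
  ∀ ε > 0, ∃ (κ : Type) (c : (Fin n → ℤ) → κ) (L₀ : ℕ), (Set.range c).Finite ∧
    ∀ v v', c v = c v' → Sparse {x | x ∈ Γ ∧ x - (v - v') ∉ Γ} ε L₀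

theorem Sparse.mono {E : Set (Fin n → ℤ)} {ε ε' : ℝ} {L₀ L₁ : ℕ} (h : Sparse E ε L₀)
    (hε : ε ≤ ε') (hL : L₀ ≤ L₁) : Sparse E ε' L₁ := fun L hL' z =>
  (h L (hL.trans hL') z).trans (mul_le_mul_of_nonneg_right hε (by positivity))

theorem Sparse.subset {E E' : Set (Fin n → ℤ)} {ε : ℝ} {L₀ : ℕ} (h : Sparse E ε L₀)
    (hE : E' ⊆ E) : Sparse E' ε L₀ := fun L hL' z =>
  le_trans (by
    exact_mod_cast cnt_le_cnt_of_surj id fun y hy hy' => ⟨y, hy, hE hy', rfl⟩) (h L hL' z)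

theorem Sparse.union {E E' : Set (Fin n → ℤ)} {ε ε' : ℝ} {L₀ : ℕ} (h : Sparse E ε L₀)
    (h' : Sparse E' ε' L₀) : Sparse (E ∪ E') (ε + ε') L₀ := fun L hL z => by
  have h1 : (cnt (E ∪ E') (box z L) : ℝ) ≤ cnt E (box z L) + cnt E' (box z L) := by
    exact_mod_cast cnt_union_le E E' _
  linarith [h L hL z, h' L hL z, add_mul ε ε' ((L : ℝ) ^ n)]

theorem almostPer_univ : AlmostPer (Set.univ : Set (Fin n → ℤ)) := by
  intro ε hε
  refine ⟨Unit, fun _ => (), 0, Set.toFinite _, fun v v' _ L _ z => ?_⟩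
  have : cnt {x | x ∈ Set.univ ∧ x - (v - v') ∉ Set.univ} (box z L) = 0 := by simp [cnt]
  rw [this]
  push_cast
  positivity

/-- The polynomial `(L + a)ⁿ` is equivalent to `Lⁿ`. -/
theorem eventually_add_pow_le (n a : ℕ) {ε : ℝ} (hε : 0 < ε) :
    ∀ᶠ L : ℕ in atTop, ((L : ℝ) + a) ^ n ≤ (1 + ε) * (L : ℝ) ^ n := by
  have h1 : Tendsto (fun L : ℕ => (1 + (a : ℝ) / L) ^ n) atTop (𝓝 ((1 + 0) ^ n)) :=
    (tendsto_const_nhds.add (tendsto_const_div_atTop_nhds_zero_nat (a : ℝ))).pow n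
  have h2 : ∀ᶠ L : ℕ in atTop, (1 + (a : ℝ) / L) ^ n < 1 + ε :=
    h1.eventually_lt_const (by simpa using hε)
  filter_upwards [h2, eventually_gt_atTop 0] with L hL hL0
  have hL0' : (0 : ℝ) < L := by exact_mod_cast hL0
  have : ((L : ℝ) + a) ^ n = (1 + (a : ℝ) / L) ^ n * L ^ n := by
    rw [← mul_pow]; congr 1; field_simp
  rw [this]
  exact mul_le_mul_of_nonneg_right hL.le (by positivity)

/-- Cubes at bounded distance from each other contain about as many elements of `Γ`. -/
theorem cnt_box_le_near (Γ : Set (Fin n → ℤ)) {z z' : Fin n → ℤ} {M : ℕ}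
    (h : ∀ i, |z i - z' i| ≤ M) (L : ℕ) :
    (cnt Γ (box z L) : ℝ) ≤ cnt Γ (box z' L) + (((L : ℝ) + (2 * M : ℕ)) ^ n - L ^ n) := by
  have h1 : box z L ⊆ box (fun i => z' i - M) (L + 2 * M) := by
    intro x hx
    rw [mem_box] at *
    intro i
    have := hx i
    have := abs_le.mp (h i)
    push_cast
    omega
  have h2 : box z' L ⊆ box (fun i => z' i - M) (L + 2 * M) := by
    intro x hx
    rw [mem_box] at *
    intro i
    have := hx i
    push_cast
    omega
  have h3 := cnt_mono Γ h1
  have h4 := cnt_le_cnt_add_card_sub Γ h2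
  rw [card_box, card_box] at h4
  have h5 : (cnt Γ (box z L) : ℝ) + (L : ℝ) ^ n ≤
      cnt Γ (box z' L) + ((L : ℝ) + (2 * M : ℕ)) ^ n := by
    exact_mod_cast (Nat.add_le_add_right h3 _).trans h4
  linarith

/-- In an almost periodic set, all large cubes of the same size contain about as many points. -/
theorem AlmostPer.oscillation {Γ : Set (Fin n → ℤ)} (hΓ : AlmostPer Γ) {ε : ℝ} (hε : 0 < ε) :
    ∃ L₀ : ℕ, ∀ L ≥ L₀, ∀ z z',
      (cnt Γ (box z L) : ℝ) ≤ cnt Γ (box z' L) + ε * L ^ n := by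
  obtain ⟨κ, c, L₀, hfin, hc⟩ := hΓ (ε / 4) (by positivity)
  -- one representative of each colour
  have hrep : ∀ k ∈ Set.range c, ∃ v, c v = k := fun k hk => hk
  choose! rep hrep using hrep
  obtain ⟨M, hM⟩ : ∃ M : ℕ, ∀ k ∈ Set.range c, ∀ i, |rep k i| ≤ M := by
    have hf : (rep '' Set.range c).Finite := hfin.image _
    obtain ⟨M, hM⟩ := (hf.image (fun v => ∑ i, (|v i|).toNat)).bddAbove
    refine ⟨M, fun k hk i => ?_⟩
    have h1 : ∑ i, (|rep k i|).toNat ≤ M := hM ⟨_, ⟨k, hk, rfl⟩, rfl⟩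
    have h2 : (|rep k i|).toNat ≤ ∑ i, (|rep k i|).toNat :=
      Finset.single_le_sum (f := fun i => (|rep k i|).toNat) (fun _ _ => Nat.zero_le _)
        (Finset.mem_univ i)
    have h3 := Int.self_le_toNat (|rep k i|)
    omega
  obtain ⟨L₁, hL₁⟩ := eventually_atTop.mp
    (eventually_add_pow_le n (2 * M) (show (0 : ℝ) < ε / 4 by positivity))
  -- translating a cube by an almost period
  have trans : ∀ v v', c v = c v' → ∀ L ≥ L₀,
      (cnt Γ (box v L) : ℝ) ≤ cnt Γ (box v' L) + ε / 4 * L ^ n := by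
    intro v v' hvv L hL
    have h1 : cnt Γ (box v L) ≤
        cnt {x | x ∈ Γ ∧ x - (v - v') ∉ Γ} (box v L) + cnt Γ (box v' L) := by
      have hA : cnt Γ (box v L) ≤
          cnt ({x | x ∈ Γ ∧ x - (v - v') ∉ Γ} ∪ {x | x - (v - v') ∈ Γ}) (box v L) := by
        refine cnt_le_cnt_of_surj id fun y hy hy' => ⟨y, hy, ?_, rfl⟩
        by_cases h : y - (v - v') ∈ Γ
        · exact Or.inr h
        · exact Or.inl ⟨hy', h⟩
      have hB : cnt {x | x - (v - v') ∈ Γ} (box v L) ≤ cnt Γ (box v' L) := by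
        refine cnt_le_cnt_of_surj (fun x => x + (v - v')) fun y hy hy' =>
          ⟨y - (v - v'), ?_, hy', by simp⟩
        rw [mem_box] at *
        intro i
        have := hy i
        simp only [Pi.sub_apply]
        omega
      exact hA.trans ((cnt_union_le _ _ _).trans (Nat.add_le_add_left hB _))
    have h2 := hc v v' hvv L hL v
    have h3 : (cnt Γ (box v L) : ℝ) ≤
      cnt {x | x ∈ Γ ∧ x - (v - v') ∉ Γ} (box v L) + cnt Γ (box v' L) := by exact_mod_cast h1
    linarith
  refine ⟨max L₀ L₁, fun L hL z z' => ?_⟩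
  have hL0 : L ≥ L₀ := (le_max_left _ _).trans hL
  have hb := hL₁ L ((le_max_right _ _).trans hL)
  have e1 := trans z (rep (c z)) (hrep _ ⟨z, rfl⟩).symm L hL0
  have e2 := trans (rep (c z')) z' (hrep _ ⟨z', rfl⟩) L hL0
  have e3 := cnt_box_le_near Γ (z := rep (c z)) (z' := 0) (M := M)
    (fun i => by simpa using hM _ ⟨z, rfl⟩ i) L
  have e4 := cnt_box_le_near Γ (z := 0) (z' := rep (c z')) (M := M)
    (fun i => by simpa using hM _ ⟨z', rfl⟩ i) L
  linarith

theorem cnt_box_div_le_one (Γ : Set (Fin n → ℤ)) (z : Fin n → ℤ) (L : ℕ) :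
    (cnt Γ (box z L) : ℝ) / L ^ n ≤ 1 := by
  refine div_le_one_of_le₀ ?_ (by positivity)
  have := cnt_le_card Γ (box z L)
  rw [card_box] at this
  exact_mod_cast this

/-- Almost periodic sets have a uniform density. -/
theorem AlmostPer.exists_uDens {Γ : Set (Fin n → ℤ)} (hΓ : AlmostPer Γ) : ∃ D, UDens Γ D := by
  set d : ℕ → ℝ := fun L => (cnt Γ (box 0 L) : ℝ) / L ^ n with hd
  have hd0 : ∀ L, 0 ≤ d L := fun L => by positivity
  have hd1 : ∀ L, d L ≤ 1 := fun L => cnt_box_div_le_one Γ 0 L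
  have hdL : ∀ L : ℕ, 0 < L → (cnt Γ (box 0 L) : ℝ) = d L * L ^ n := fun L hL => by
    have : (0 : ℝ) < (L : ℝ) ^ n := by positivity
    simp only [hd]; field_simp
  have key : ∀ ε > 0, ∃ L₀ : ℕ, ∀ L ≥ L₀, ∀ᶠ L' in atTop, d L' ≤ d L + ε := by
    intro ε hε
    obtain ⟨L₀, hL₀⟩ := hΓ.oscillation (half_pos (half_pos hε))
    refine ⟨max L₀ 1, fun L hL => ?_⟩
    have hLpos : 0 < L := (le_max_right L₀ 1).trans hL
    have h1 : ∀ z, (cnt Γ (box z L) : ℝ) ≤ (d L + ε / 2 / 2) * L ^ n := fun z => by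
      have := hL₀ L ((le_max_left _ _).trans hL) z 0
      rw [hdL L hLpos] at this
      linarith
    have hη : 0 < ε / 2 / (1 + ε) := by positivity
    filter_upwards [eventually_add_pow_le n L hη, eventually_gt_atTop 0] with L' h2 h3
    have h4 := cnt_box_le_of_box hLpos h1 0 L'
    have hp : (0 : ℝ) < (L' : ℝ) ^ n := by positivity
    have h5 : d L' * (L' : ℝ) ^ n ≤ (d L + ε) * (L' : ℝ) ^ n := by
      rw [← hdL L' h3]
      refine h4.trans ((mul_le_mul_of_nonneg_left h2 (by linarith [hd0 L])).trans ?_)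
      rw [← mul_assoc]
      refine mul_le_mul_of_nonneg_right ?_ hp.le
      have h6 : (d L + ε / 2 / 2) * (ε / 2 / (1 + ε)) ≤ (1 + ε) * (ε / 2 / (1 + ε)) :=
        mul_le_mul_of_nonneg_right (by linarith [hd1 L]) hη.le
      have h7 : (1 + ε) * (ε / 2 / (1 + ε)) = ε / 2 := by field_simp
      nlinarith
    exact le_of_mul_le_mul_right h5 hp
  have hbdd : IsBoundedUnder (· ≤ ·) atTop d := ⟨1, by simpa using ⟨0, fun b _ => hd1 b⟩⟩
  have hbdd' : IsBoundedUnder (· ≥ ·) atTop d := ⟨0, by simpa using ⟨0, fun b _ => hd0 b⟩⟩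
  have hle : limsup d atTop ≤ liminf d atTop := by
    refine le_of_forall_pos_le_add fun ε hε => ?_
    obtain ⟨L₀, hL₀⟩ := key ε hε
    have : limsup d atTop - ε ≤ liminf d atTop := by
      refine le_liminf_of_le hbdd.isCoboundedUnder_ge ?_
      filter_upwards [eventually_ge_atTop L₀] with L hL
      have := limsup_le_of_le hbdd'.isCoboundedUnder_le (hL₀ L hL)
      linarith
    linarith
  have hlim : Tendsto d atTop (𝓝 (limsup d atTop)) :=
    tendsto_of_le_liminf_of_limsup_le hle le_rfl hbdd hbdd'
  refine ⟨limsup d atTop, fun η hη => ?_⟩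
  obtain ⟨L₀, hL₀⟩ := hΓ.oscillation (half_pos hη)
  obtain ⟨L₁, hL₁⟩ := Metric.tendsto_atTop.mp hlim (η / 2) (half_pos hη)
  refine ⟨max (max L₀ L₁) 1, fun L hL z => ?_⟩
  have hL0 : L ≥ L₀ := (le_max_left _ _).trans ((le_max_left _ _).trans hL)
  have hL1 : L ≥ L₁ := (le_max_right _ _).trans ((le_max_left _ _).trans hL)
  have hLpos : 0 < L := (le_max_right _ _).trans hL
  have h1 := hL₀ L hL0 z 0
  have h2 := hL₀ L hL0 0 z
  have h3 := hL₁ L hL1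
  rw [Real.dist_eq] at h3
  have hp : (0 : ℝ) < (L : ℝ) ^ n := by positivity
  have h4 : |(cnt Γ (box 0 L) : ℝ) - limsup d atTop * L ^ n| ≤ η / 2 * L ^ n := by
    rw [hdL L hLpos, ← sub_mul, abs_mul, abs_of_pos hp]
    exact mul_le_mul_of_nonneg_right h3.le hp.le
  rw [abs_le] at h4 ⊢
  constructor <;> linarith [h4.1, h4.2]

theorem UDens.nonneg {Γ : Set (Fin n → ℤ)} {D : ℝ} (h : UDens Γ D) : 0 ≤ D := by
  by_contra! hD
  obtain ⟨L₀, hL₀⟩ := h (-D / 2) (by linarith)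
  have h1 := (abs_le.mp (hL₀ (max L₀ 1) (le_max_left _ _) 0)).2
  have hp : (0 : ℝ) < ((max L₀ 1 : ℕ) : ℝ) ^ n := by
    have : 0 < max L₀ 1 := by omega
    positivity
  have h2 : (0 : ℝ) ≤ cnt Γ (box 0 (max L₀ 1)) := by positivity
  nlinarith

theorem intBall_eq_box {R : ℝ} (hR : 0 < R) :
    intBall n R = (box (fun _ => 1 - ⌈R⌉) (2 * ⌈R⌉₊ - 1) : Finset (Fin n → ℤ)) := by
  ext x
  simp only [intBall, Set.mem_ofPred_eq, Finset.mem_coe, mem_box]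
  refine forall_congr' fun i => ?_
  have h0 : 0 < ⌈R⌉₊ := Nat.ceil_pos.mpr hR
  have h1 : ((⌈R⌉₊ : ℕ) : ℤ) = ⌈R⌉ := Int.natCast_ceil_eq_ceil hR.le
  have h2 : |(x i : ℝ)| < R ↔ |x i| < ⌈R⌉ := by
    rw [Int.lt_ceil]; push_cast; rfl
  rw [h2, abs_lt]
  omega

theorem UDens.upperDensity_eq {Γ : Set (Fin n → ℤ)} {D : ℝ} (h : UDens Γ D) :
    upperDensity Γ = D := by
  classical
  refine Tendsto.limsup_eq ?_
  rw [Metric.tendsto_nhds]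
  intro ε hε
  obtain ⟨L₀, hL₀⟩ := h (ε / 2) (half_pos hε)
  filter_upwards [eventually_gt_atTop (L₀ : ℝ), eventually_gt_atTop 0] with R hR hR0
  have h0 : 0 < ⌈R⌉₊ := Nat.ceil_pos.mpr hR0
  have h1 : L₀ < ⌈R⌉₊ := by
    rw [Nat.lt_ceil]; exact hR
  set L := 2 * ⌈R⌉₊ - 1 with hL
  have hLpos : 0 < L := by omega
  have h2 := hL₀ L (by omega) (fun _ => 1 - ⌈R⌉)
  rw [intBall_eq_box hR0, Set.ncard_coe_finset, card_box]
  have h3 : (Γ ∩ ↑(box (fun _ : Fin n => 1 - ⌈R⌉) L)).ncard =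
      cnt Γ (box (fun _ => 1 - ⌈R⌉) L) := by
    rw [cnt, ← Set.ncard_coe_finset]
    congr 1
    ext x
    simp [and_comm]
  rw [h3, Real.dist_eq]
  have hp : (0 : ℝ) < (L : ℝ) ^ n := by positivity
  push_cast
  have h4 : (cnt Γ (box (fun _ => 1 - ⌈R⌉) L) : ℝ) / L ^ n - D =
      (cnt Γ (box (fun _ => 1 - ⌈R⌉) L) - D * L ^ n) / L ^ n := by field_simp
  rw [h4, abs_div, abs_of_pos hp, div_lt_iff₀ hp]
  nlinarith

/-! ### Affine steps and the sets of iterated images -/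

/-- The discretization of the affine map `x ↦ A x + θ`. -/
noncomputable def affStep (A : Matrix (Fin n) (Fin n) ℝ) (θ : Fin n → ℝ) (x : Fin n → ℤ) :
    Fin n → ℤ :=
  proj (A.mulVec (castVec x) + θ)

/-- The image of `ℤⁿ` under the first `k` affine steps, with linear parts given by `Q` and
translation parts by `θ`. -/
def gam (Q : OrthSeq n) (θ : ℕ → Fin n → ℝ) : ℕ → Set (Fin n → ℤ)
  | 0 => Set.univ
  | k + 1 => affStep (Q k).1 (θ k) '' gam Q θ k

theorem disc_eq_affStep (A : Matrix (Fin n) (Fin n) ℝ) : disc A = affStep A 0 := by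
  funext x
  simp only [disc, affStep, add_zero]
  rfl

theorem range_iter_eq_gam (Q : OrthSeq n) (k : ℕ) : Set.range (iter Q k) = gam Q 0 k := by
  induction k with
  | zero => simp [iter, gam]
  | succ k ih => rw [iter, gam, Set.range_comp, ih, disc_eq_affStep]; rfl

theorem gam_congr (Q : OrthSeq n) {θ θ' : ℕ → Fin n → ℝ} {k : ℕ} (h : ∀ j < k, θ j = θ' j) :
    gam Q θ k = gam Q θ' k := by
  induction k with
  | zero => rfl
  | succ k ih => rw [gam, gam, ih fun j hj => h j (by omega), h k (by omega)]

theorem p_add_int (x : ℝ) (k : ℤ) : p (x + k) = p x + k := by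
  rw [p, p, ← Int.ceil_add_intCast]; congr 1; ring

theorem sub_half_le_p (x : ℝ) : x - 1 / 2 ≤ p x := by
  have := ((p_eq_iff x (p x)).mp rfl).2; linarith

theorem p_lt_add_half (x : ℝ) : (p x : ℝ) < x + 1 / 2 := by
  have := ((p_eq_iff x (p x)).mp rfl).1; linarith

/-- Rounding is locally constant away from the half-integers. -/
theorem p_add_of_far {y e s : ℝ} (hs : ∀ k : ℤ, s ≤ |y - 1 / 2 - k|) (he : |e| < s) :
    p (y + e) = p y := by
  have h1 := hs (p y)
  have h2 := hs (p y - 1)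
  have h3 := sub_half_le_p y
  have h4 := p_lt_add_half y
  push_cast at h2
  rw [abs_of_nonpos (by linarith)] at h1
  rw [abs_of_nonneg (by linarith)] at h2
  rw [abs_lt] at he
  rw [p_eq_iff]
  constructor <;> linarith [he.1, he.2]

theorem affStep_add (A : Matrix (Fin n) (Fin n) ℝ) (θ : Fin n → ℝ) (x t t' : Fin n → ℤ) :
    affStep A θ (x + t) =
      affStep A (A.mulVec (castVec t) + θ - castVec t') x + t' := by
  funext i
  simp only [affStep, proj, castVec_add, Matrix.mulVec_add, Pi.add_apply, Pi.sub_apply,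
    castVec_apply]
  rw [← p_add_int]
  congr 1
  ring

/-! ### Orthogonal matrices -/

theorem orth_mul_transpose (A : Matrix.orthogonalGroup (Fin n) ℝ) : A.1 * A.1.transpose = 1 :=
  Matrix.mem_orthogonalGroup_iff _ _ |>.mp A.2

theorem orth_transpose_mul (A : Matrix.orthogonalGroup (Fin n) ℝ) : A.1.transpose * A.1 = 1 :=
  Matrix.mem_orthogonalGroup_iff' _ _ |>.mp A.2

theorem abs_orth_apply_le (A : Matrix.orthogonalGroup (Fin n) ℝ) (i j : Fin n) :
    |A.1 i j| ≤ 1 := by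
  simpa using entry_norm_bound_of_unitary A.2 i j

theorem abs_mulVec_le {A : Matrix (Fin n) (Fin n) ℝ} {a : ℝ} (hA : ∀ i j, |A i j| ≤ a)
    {v : Fin n → ℝ} {M : ℝ} (hv : ∀ i, |v i| ≤ M) (i : Fin n) : |A.mulVec v i| ≤ n * (a * M) := by
  calc |A.mulVec v i| ≤ ∑ j, |A i j * v j| := by
        rw [Matrix.mulVec, dotProduct]; exact Finset.abs_sum_le_sum_abs _ _
    _ ≤ ∑ _j : Fin n, a * M := Finset.sum_le_sum fun j _ => by
        rw [abs_mul]
        exact mul_le_mul (hA i j) (hv j) (abs_nonneg _) ((abs_nonneg _).trans (hA i j))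
    _ = n * (a * M) := by simp

theorem abs_orth_mulVec_le (A : Matrix.orthogonalGroup (Fin n) ℝ) {v : Fin n → ℝ} {M : ℝ}
    (hv : ∀ i, |v i| ≤ M) (i : Fin n) : |A.1.mulVec v i| ≤ n * M := by
  simpa using abs_mulVec_le (abs_orth_apply_le A) hv i

theorem abs_le_of_orth_mulVec (A : Matrix.orthogonalGroup (Fin n) ℝ) {v : Fin n → ℝ} {M : ℝ}
    (hv : ∀ i, |A.1.mulVec v i| ≤ M) (i : Fin n) : |v i| ≤ n * M := by
  have h := abs_mulVec_le (A := A.1.transpose) (fun i j => abs_orth_apply_le A j i) hv i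
  rwa [Matrix.mulVec_mulVec, orth_transpose_mul, Matrix.one_mulVec, one_mul] at h

/-- The integer vector `w` obtained by rounding `Aᵀ v` satisfies `A w ≈ v`. -/
theorem exists_near_preimage (A : Matrix.orthogonalGroup (Fin n) ℝ) (v : Fin n → ℝ) :
    ∃ w : Fin n → ℤ, ∀ i, |A.1.mulVec (castVec w) i - v i| ≤ n := by
  refine ⟨proj (A.1.transpose.mulVec v), fun i => ?_⟩
  have h1 : ∀ i, |(castVec (proj (A.1.transpose.mulVec v)) - A.1.transpose.mulVec v) i| ≤ 1 := by
    intro i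
    have h1 := sub_half_le_p (A.1.transpose.mulVec v i)
    have h2 := p_lt_add_half (A.1.transpose.mulVec v i)
    simp only [Pi.sub_apply, castVec_apply, proj]
    rw [abs_le]
    constructor <;> linarith
  have h2 := abs_orth_mulVec_le A h1 i
  rw [Matrix.mulVec_sub, Matrix.mulVec_mulVec, orth_mul_transpose, Matrix.one_mulVec] at h2
  simpa using h2

/-! ### Images of almost periodic sets are almost periodic -/

theorem exists_pos_forall_le {ι : Type*} (S : Finset ι) (f : ι → ℝ) (hf : ∀ i ∈ S, 0 < f i) :
    ∃ s > 0, ∀ i ∈ S, s ≤ f i := by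
  classical
  induction S using Finset.induction_on with
  | empty => exact ⟨1, one_pos, by simp⟩
  | insert a S _ ih =>
    obtain ⟨s, hs, h⟩ := ih fun i hi => hf i (Finset.mem_insert_of_mem hi)
    refine ⟨min s (f a), lt_min hs (hf a (Finset.mem_insert_self _ _)), fun i hi => ?_⟩
    rcases Finset.mem_insert.mp hi with rfl | hi
    · exact min_le_right _ _
    · exact (min_le_left _ _).trans (h i hi)

theorem exists_gap_of_irrational {α : ℝ} (hα : Irrational α) (K : ℕ) :
    ∃ s > 0, ∀ d : ℤ, d ≠ 0 → |d| ≤ K → ∀ k : ℤ, 2 * s ≤ |d * α - k| := by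
  obtain ⟨s, hs, h⟩ := exists_pos_forall_le ((Finset.Icc (-K : ℤ) K).erase 0)
    (fun d => |d * α - round (d * α)|) (fun d hd => by
      rw [abs_pos, sub_ne_zero]
      exact (hα.intCast_mul (Finset.mem_erase.mp hd).1).ne_int _)
  refine ⟨s / 2, half_pos hs, fun d hd hdK k => ?_⟩
  have h1 := h d (Finset.mem_erase.mpr ⟨hd, Finset.mem_Icc.mpr (abs_le.mp hdK)⟩)
  have h2 := round_le (d * α) k
  linarith

/-- If some coefficient of a linear form `α` is irrational, the integer points at which
`α · x + β` is very close to an integer are sparse. -/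
theorem sparse_near_int_of_irrational {α : Fin n → ℝ} {j : Fin n} (hj : Irrational (α j))
    {ε : ℝ} (hε : 0 < ε) : ∃ s > 0, ∃ L₀ : ℕ, ∀ β : ℝ,
      Sparse {x | ∃ k : ℤ, |α ⬝ᵥ castVec x + β - k| < s} ε L₀ := by
  classical
  obtain ⟨K, hK⟩ := exists_nat_gt (2 / ε)
  obtain ⟨s, hs, hgap⟩ := exists_gap_of_irrational hj K
  refine ⟨s, hs, K + 1, fun β L hL z => ?_⟩
  -- on each line in the direction `j`, such points are at distance more than `K`
  set T : Finset (Fin n → ℤ) := Fintype.piFinset fun i =>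
    if i = j then Finset.Ico 0 ((L / (K + 1) + 1 : ℕ) : ℤ) else Finset.Ico (z i) (z i + L) with hT
  have hcard : T.card = (L / (K + 1) + 1) * L ^ (n - 1) := by
    rw [hT, Fintype.card_piFinset, ← Finset.mul_prod_erase _ _ (Finset.mem_univ j)]
    congr 1
    · simp only [if_true, Int.card_Ico, sub_zero, Int.toNat_natCast]
    · rw [Finset.prod_congr rfl (g := fun _ => L)]
      · simp
      · intro i hi
        rw [if_neg (Finset.mem_erase.mp hi).1]
        simp
  have hle : cnt {x | ∃ k : ℤ, |α ⬝ᵥ castVec x + β - k| < s} (box z L) ≤ T.card := by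
    refine Finset.card_le_card_of_injOn
      (fun x => Function.update x j ((x j - z j) / ((K + 1 : ℕ) : ℤ))) ?_ ?_
    · intro x hx
      simp only [Finset.coe_filter, Set.mem_ofPred_eq, mem_box] at hx
      simp only [hT, Finset.mem_coe, Fintype.mem_piFinset]
      intro i
      by_cases hi : i = j
      · subst hi
        simp only [Function.update_self, if_true, Finset.mem_Ico]
        have h1 := hx.1 i
        have hK0 : (0 : ℤ) < ((K + 1 : ℕ) : ℤ) := by positivity
        refine ⟨Int.ediv_nonneg (by omega) hK0.le, ?_⟩
        have : (x i - z i) / ((K + 1 : ℕ) : ℤ) ≤ (L : ℤ) / ((K + 1 : ℕ) : ℤ) :=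
          Int.ediv_le_ediv hK0 (by omega)
        push_cast at this ⊢
        omega
      · simp only [Function.update_of_ne hi, if_neg hi, Finset.mem_Ico]
        exact hx.1 i
    · intro x hx y hy hxy
      simp only [Finset.coe_filter, Set.mem_ofPred_eq] at hx hy
      obtain ⟨k, hk⟩ := hx.2
      obtain ⟨k', hk'⟩ := hy.2
      have hoff : ∀ i, i ≠ j → x i = y i := fun i hi => by
        have := congrFun hxy i
        simpa [Function.update_of_ne hi] using this
      have hjj : (x j - z j) / ((K + 1 : ℕ) : ℤ) = (y j - z j) / ((K + 1 : ℕ) : ℤ) := by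
        have := congrFun hxy j
        simpa using this
      have hd : |x j - y j| ≤ K := by
        have hK0 : (0 : ℤ) < ((K + 1 : ℕ) : ℤ) := by positivity
        have e1 := Int.mul_ediv_add_emod (x j - z j) ((K + 1 : ℕ) : ℤ)
        have e2 := Int.mul_ediv_add_emod (y j - z j) ((K + 1 : ℕ) : ℤ)
        have m1 := Int.emod_nonneg (x j - z j) hK0.ne'
        have m2 := Int.emod_nonneg (y j - z j) hK0.ne'
        have m3 := Int.emod_lt_of_pos (x j - z j) hK0
        have m4 := Int.emod_lt_of_pos (y j - z j) hK0
        rw [hjj] at e1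
        rw [abs_le]
        push_cast at *
        constructor <;> linarith
      have hxyj : x j = y j := by
        by_contra hne
        have h1 := hgap (x j - y j) (sub_ne_zero.mpr hne) hd (k - k')
        have h2 : α ⬝ᵥ castVec x - α ⬝ᵥ castVec y = ((x j - y j : ℤ) : ℝ) * α j := by
          rw [← dotProduct_sub, dotProduct, Finset.sum_eq_single j]
          · simp; ring
          · intro i _ hi
            simp [hoff i hi]
          · simp
        rw [← h2] at h1
        have h3 : α ⬝ᵥ castVec x - α ⬝ᵥ castVec y - ((k - k' : ℤ) : ℝ) =
            (α ⬝ᵥ castVec x + β - k) - (α ⬝ᵥ castVec y + β - k') := by push_cast; ring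
        rw [h3] at h1
        have := (abs_sub (α ⬝ᵥ castVec x + β - k) (α ⬝ᵥ castVec y + β - k'))
        linarith
      funext i
      by_cases hi : i = j
      · rw [hi, hxyj]
      · exact hoff i hi
  have hn : n = (n - 1) + 1 := by have := j.pos; omega
  have hK1 : (0 : ℝ) < K := lt_trans (by positivity) hK
  calc (cnt {x | ∃ k : ℤ, |α ⬝ᵥ castVec x + β - k| < s} (box z L) : ℝ)
      ≤ ((L / (K + 1) + 1) * L ^ (n - 1) : ℕ) := by rw [← hcard]; exact_mod_cast hle
    _ ≤ (ε * L) * L ^ (n - 1) := by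
        push_cast
        refine mul_le_mul_of_nonneg_right ?_ (by positivity)
        have h1 : ((L / (K + 1) : ℕ) : ℝ) ≤ L / K := by
          refine Nat.cast_div_le.trans ?_
          push_cast
          gcongr
          linarith
        have h2 : (1 : ℝ) ≤ L / K := by
          rw [le_div_iff₀ hK1]
          have : ((K + 1 : ℕ) : ℝ) ≤ L := by exact_mod_cast hL
          push_cast at this
          linarith
        have h3 : (L : ℝ) / K * 2 ≤ ε * L := by
          rw [div_mul_eq_mul_div, div_le_iff₀ hK1]
          have h4 : 2 < K * ε := (div_lt_iff₀ hε).mp hK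
          nlinarith [(Nat.cast_nonneg L : (0 : ℝ) ≤ L)]
        linarith
    _ = ε * L ^ n := by rw [mul_assoc, ← pow_succ', ← hn]

/-- Rational linear forms, on the other hand, take integer values as soon as they take values
close to integers. The two cases are stated together. -/
theorem sparse_near_int (α : Fin n → ℝ) {ε : ℝ} (hε : 0 < ε) :
    ∃ s > 0, ∃ L₀ : ℕ, ∀ β : ℝ,
      Sparse {x | (∃ a : Fin n → ℤ, ∃ b : ℤ, |α ⬝ᵥ castVec a - b| < s ∧ α ⬝ᵥ castVec a ≠ b) ∧
        ∃ k : ℤ, |α ⬝ᵥ castVec x + β - k| < s} ε L₀ := by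
  by_cases h : ∃ j, Irrational (α j)
  · obtain ⟨j, hj⟩ := h
    obtain ⟨s, hs, L₀, H⟩ := sparse_near_int_of_irrational hj hε
    exact ⟨s, hs, L₀, fun β => (H β).subset fun x hx => hx.2⟩
  · push Not at h
    have h' : ∀ j, ∃ r : ℚ, (r : ℝ) = α j := fun j => by simpa [Irrational] using h j
    choose r hr using h'
    set q : ℕ := ∏ j, (r j).den with hq
    have hqpos : (0 : ℝ) < q := by
      rw [hq]; push_cast
      exact Finset.prod_pos fun j _ => by exact_mod_cast (r j).den_pos
    have hint : ∀ j, ∃ m : ℤ, (q : ℝ) * α j = m := fun j => by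
      obtain ⟨c, hc⟩ : (r j).den ∣ q := Finset.dvd_prod_of_mem _ (Finset.mem_univ j)
      refine ⟨c * (r j).num, ?_⟩
      rw [← hr j, hc]
      have : ((r j : ℚ) : ℝ) * (r j).den = (r j).num := by exact_mod_cast Rat.mul_den_eq_num (r j)
      push_cast
      linear_combination (c : ℝ) * this
    choose m hm using hint
    refine ⟨1 / q, by positivity, 0, fun β L _ z => ?_⟩
    have : cnt {x | (∃ a : Fin n → ℤ, ∃ b : ℤ, |α ⬝ᵥ castVec a - b| < 1 / q ∧
        α ⬝ᵥ castVec a ≠ b) ∧ ∃ k : ℤ, |α ⬝ᵥ castVec x + β - k| < 1 / q} (box z L) = 0 := by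
      refine cnt_eq_zero ?_
      rintro x - ⟨⟨a, b, hab, hne⟩, -⟩
      have h1 : (q : ℝ) * (α ⬝ᵥ castVec a) = ((∑ j, m j * a j : ℤ) : ℝ) := by
        rw [dotProduct, Finset.mul_sum]
        push_cast
        refine Finset.sum_congr rfl fun j _ => ?_
        rw [← hm j, castVec_apply]; ring
      have h2 : |((∑ j, m j * a j - q * b : ℤ) : ℝ)| < 1 := by
        have : ((∑ j, m j * a j - q * b : ℤ) : ℝ) = q * (α ⬝ᵥ castVec a - b) := by
          rw [mul_sub, h1]; push_cast; ring
        rw [this, abs_mul, abs_of_pos hqpos]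
        calc (q : ℝ) * |α ⬝ᵥ castVec a - b| < q * (1 / q) := mul_lt_mul_of_pos_left hab hqpos
          _ = 1 := by field_simp
      have h3 : (∑ j, m j * a j - q * b : ℤ) = 0 := by
        rw [← Int.abs_lt_one_iff]; exact_mod_cast h2
      apply hne
      have h4 : (q : ℝ) * (α ⬝ᵥ castVec a) = q * b := by
        rw [h1]
        have : ((∑ j, m j * a j : ℤ) : ℝ) = ((q * b : ℤ) : ℝ) := by
          congr 1; linarith
        rw [this]; push_cast; ring
      exact mul_left_cancel₀ hqpos.ne' h4
    rw [this]
    push_cast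
    positivity

theorem Sparse.iUnion {ι : Type*} [Fintype ι] {E : ι → Set (Fin n → ℤ)} {ε : ℝ} {L₀ : ℕ}
    (h : ∀ i, Sparse (E i) ε L₀) : Sparse (⋃ i, E i) (Fintype.card ι * ε) L₀ := by
  classical
  have key : ∀ S : Finset ι, Sparse (⋃ i ∈ S, E i) (S.card * ε) L₀ := by
    intro S
    induction S using Finset.induction_on with
    | empty =>
      intro L _ z
      simp [cnt]
    | insert a S ha ih =>
      rw [Finset.set_biUnion_insert, Finset.card_insert_of_notMem ha]
      refine ((h a).union ih).mono (le_of_eq ?_) le_rfl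
      push_cast; ring
  simpa using key Finset.univ

/-- The image of an almost periodic set under the discretization of an affine isometry is almost
periodic: if `a` is an almost period of `Γ` and `A a` is close to an integer vector `b`, then `b`
is an almost period of the image, as translating by `a` changes the rounding only at the points
whose image is close to a tie. -/
theorem AlmostPer.image {Γ : Set (Fin n → ℤ)} (hΓ : AlmostPer Γ)
    (A : Matrix.orthogonalGroup (Fin n) ℝ) (θ : Fin n → ℝ) :
    AlmostPer (affStep A.1 θ '' Γ) := by
  intro ε hε
  set C : ℝ := (4 * n + 1 : ℝ) ^ n with hC
  have hCpos : 0 < C := by positivity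
  obtain ⟨κ, c, L₁, hfin, hc⟩ := hΓ (ε / (2 * C)) (by positivity)
  have hrow := fun i => sparse_near_int (A.1 i)
    (show (0 : ℝ) < ε / (2 * C * (n + 1)) by positivity)
  choose s hs L₂ hL₂ using hrow
  obtain ⟨s₀, hs₀, hs₀le⟩ := exists_pos_forall_le Finset.univ s fun i _ => hs i
  obtain ⟨M, hM⟩ := exists_nat_gt (1 / s₀)
  have hMpos : (0 : ℝ) < M := lt_trans (by positivity) hM
  set L₃ := max L₁ (Finset.univ.sup L₂) with hL₃
  choose w hw using fun v : Fin n → ℤ => exists_near_preimage A (castVec v)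
  refine ⟨κ × (Fin n → ℤ), fun v => (c (w v), fun i =>
    ⌊(M : ℝ) * (A.1.mulVec (castVec (w v)) i - v i)⌋), max L₃ 1, ?_, ?_⟩
  · refine (hfin.prod (Set.finite_Icc (fun _ : Fin n => -((M * n : ℕ) : ℤ))
      (fun _ => ((M * n : ℕ) : ℤ)))).subset ?_
    rintro _ ⟨v, rfl⟩
    refine ⟨⟨_, rfl⟩, fun i => ?_, fun i => ?_⟩
    · have := (abs_le.mp (hw v i)).1
      simp only [castVec_apply] at this
      rw [Int.le_floor]
      push_cast
      nlinarith
    · have := (abs_le.mp (hw v i)).2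
      simp only [castVec_apply] at this
      refine Int.floor_le_iff.mpr ?_
      push_cast
      nlinarith
  · intro v v' hvv L hL z
    obtain ⟨hcv, hfl⟩ := Prod.mk.inj hvv
    set a := w v - w v' with ha
    set b := v - v' with hb
    have hab : ∀ i, |A.1.mulVec (castVec a) i - b i| < s₀ := by
      intro i
      have h1 := Int.abs_sub_lt_one_of_floor_eq_floor (congrFun hfl i)
      have h2 : (M : ℝ) * (A.1.mulVec (castVec (w v)) i - v i) -
          M * (A.1.mulVec (castVec (w v')) i - v' i) =
          M * (A.1.mulVec (castVec a) i - b i) := by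
        simp only [ha, hb, castVec_sub, Matrix.mulVec_sub, Pi.sub_apply]
        push_cast; ring
      rw [h2, abs_mul, abs_of_pos hMpos] at h1
      have h3 : 1 < s₀ * M := by rwa [div_lt_iff₀' hs₀] at hM
      by_contra hcon
      push Not at hcon
      nlinarith
    set T : Set (Fin n → ℤ) := ⋃ i, {x | (∃ a : Fin n → ℤ, ∃ b : ℤ,
        |A.1 i ⬝ᵥ castVec a - b| < s i ∧ A.1 i ⬝ᵥ castVec a ≠ b) ∧
        ∃ k : ℤ, |A.1 i ⬝ᵥ castVec x + (θ i - 1 / 2) - k| < s i} with hT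
    set E : Set (Fin n → ℤ) := {x | x ∈ Γ ∧ x - a ∉ Γ} ∪ T with hE
    have hsp : Sparse E (ε / C) L₃ := by
      have h1 : Sparse {x | x ∈ Γ ∧ x - a ∉ Γ} (ε / (2 * C)) L₃ :=
        (hc _ _ hcv).mono le_rfl (le_max_left _ _)
      have h2 : Sparse T (Fintype.card (Fin n) * (ε / (2 * C * (n + 1)))) L₃ :=
        Sparse.iUnion fun i => (hL₂ i _).mono le_rfl
          ((Finset.le_sup (Finset.mem_univ i)).trans (le_max_right _ _))
      refine (h1.union h2).mono ?_ le_rfl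
      have h3 : (n : ℝ) * (ε / (2 * C * (n + 1))) ≤ ε / (2 * C) := by
        rw [mul_div_assoc', div_le_div_iff₀ (by positivity) (by positivity)]
        nlinarith [mul_pos hε hCpos]
      rw [Fintype.card_fin]
      calc ε / (2 * C) + n * (ε / (2 * C * (n + 1))) ≤ ε / (2 * C) + ε / (2 * C) := by linarith
        _ = ε / C := by field_simp; norm_num
    -- an affected point of the image comes from an affected point of `Γ` or from a near tie
    have hmem : ∀ y, y ∈ affStep A.1 θ '' Γ → y - b ∉ affStep A.1 θ '' Γ →
        ∃ x ∈ E, affStep A.1 θ x = y := by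
      rintro _ ⟨x, hx, rfl⟩ hy
      refine ⟨x, ?_, rfl⟩
      by_contra hxE
      simp only [hE, Set.mem_union, Set.mem_ofPred_eq, not_or, not_and, not_not] at hxE
      refine hy ⟨x - a, hxE.1 hx, ?_⟩
      funext i
      have hxi : ¬ ((∃ a : Fin n → ℤ, ∃ b : ℤ,
          |A.1 i ⬝ᵥ castVec a - b| < s i ∧ A.1 i ⬝ᵥ castVec a ≠ b) ∧
          ∃ k : ℤ, |A.1 i ⬝ᵥ castVec x + (θ i - 1 / 2) - k| < s i) := fun h =>
        hxE.2 (Set.mem_iUnion.mpr ⟨i, h⟩)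
      have habi : |A.1 i ⬝ᵥ castVec a - b i| < s i :=
        (hab i).trans_le (hs₀le i (Finset.mem_univ i))
      simp only [affStep, proj, Pi.sub_apply, Pi.add_apply, castVec_sub, Matrix.mulVec_sub]
      have e1 : A.1.mulVec (castVec x) i - A.1.mulVec (castVec a) i + θ i =
          (A.1.mulVec (castVec x) i + θ i + -(A.1 i ⬝ᵥ castVec a - b i)) + ((-b i : ℤ) : ℝ) := by
        simp only [Matrix.mulVec]; push_cast; ring
      rw [e1, p_add_int, ← sub_eq_add_neg (p _)]
      congr 1
      by_cases heq : A.1 i ⬝ᵥ castVec a = b i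
      · rw [heq]; simp
      · refine p_add_of_far (s := s i) (fun k => ?_) (by rwa [abs_neg])
        by_contra hk
        push Not at hk
        refine hxi ⟨⟨a, b i, habi, heq⟩, k, ?_⟩
        rw [← add_sub_assoc]
        exact hk
    by_cases hne : ∃ x₀, affStep A.1 θ x₀ ∈ box z L
    swap
    · have : cnt {x | x ∈ affStep A.1 θ '' Γ ∧ x - b ∉ affStep A.1 θ '' Γ} (box z L) = 0 := by
        refine cnt_eq_zero ?_
        rintro y hy ⟨⟨x, -, rfl⟩, -⟩
        exact hne ⟨x, hy⟩
      rw [this]; push_cast; positivity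
    obtain ⟨x₀, hx₀⟩ := hne
    have hL1 : 1 ≤ L := (le_max_right _ _).trans hL
    set L' : ℕ := 2 * n * (L + 1) + 1 with hL'
    have hcnt : cnt {x | x ∈ affStep A.1 θ '' Γ ∧ x - b ∉ affStep A.1 θ '' Γ} (box z L) ≤
        cnt E (box (fun i => x₀ i - (n * (L + 1) : ℕ)) L') := by
      refine cnt_le_cnt_of_surj (affStep A.1 θ) fun y hy hy' => ?_
      obtain ⟨x, hxE, rfl⟩ := hmem y hy'.1 hy'.2
      refine ⟨x, ?_, hxE, rfl⟩
      rw [mem_box] at hy hx₀ ⊢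
      have h1 : ∀ i, |A.1.mulVec (castVec (x - x₀)) i| ≤ (L + 1 : ℝ) := by
        intro i
        have e1 := sub_half_le_p (A.1.mulVec (castVec x) i + θ i)
        have e2 := p_lt_add_half (A.1.mulVec (castVec x) i + θ i)
        have e3 := sub_half_le_p (A.1.mulVec (castVec x₀) i + θ i)
        have e4 := p_lt_add_half (A.1.mulVec (castVec x₀) i + θ i)
        have e5 := hy i
        have e6 := hx₀ i
        simp only [affStep, proj, Pi.add_apply] at e5 e6
        have e7 : ((p (A.1.mulVec (castVec x) i + θ i) : ℤ) : ℝ) ≤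
          p (A.1.mulVec (castVec x₀) i + θ i) + L := by exact_mod_cast (by omega)
        have e8 : ((p (A.1.mulVec (castVec x₀) i + θ i) : ℤ) : ℝ) ≤
          p (A.1.mulVec (castVec x) i + θ i) + L := by exact_mod_cast (by omega)
        rw [castVec_sub, Matrix.mulVec_sub, Pi.sub_apply, abs_le]
        constructor <;> linarith
      intro i
      have h2 := abs_le_of_orth_mulVec A h1 i
      have h3 : |x i - x₀ i| ≤ (n * (L + 1) : ℕ) := by
        simp only [castVec_apply, Pi.sub_apply] at h2
        exact_mod_cast h2
      rw [abs_le] at h3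
      simp only [hL']
      have e9 : ((2 * n * (L + 1) + 1 : ℕ) : ℤ) = 2 * ((n * (L + 1) : ℕ) : ℤ) + 1 := by
        push_cast; ring
      rw [e9]
      omega
    have hLL' : L ≤ L' ∨ n = 0 := by
      rcases Nat.eq_zero_or_pos n with h | h
      · exact Or.inr h
      · left
        rw [hL']
        nlinarith
    rcases hLL' with hLL' | hn0
    · have h1 := hsp L' (((le_max_left _ _).trans hL).trans hLL')
        (fun i => x₀ i - (n * (L + 1) : ℕ))
      have h2 : ((L' : ℕ) : ℝ) ^ n ≤ C * (L : ℝ) ^ n := by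
        rw [hC, ← mul_pow]
        refine pow_le_pow_left₀ (by positivity) ?_ n
        have : (1 : ℝ) ≤ L := by exact_mod_cast hL1
        rw [hL']
        push_cast
        nlinarith [(Nat.cast_nonneg n : (0 : ℝ) ≤ n)]
      calc _ ≤ _ := by exact_mod_cast hcnt
        _ ≤ _ := h1
        _ ≤ ε / C * (C * (L : ℝ) ^ n) := mul_le_mul_of_nonneg_left h2 (by positivity)
        _ = ε * (L : ℝ) ^ n := by field_simp
    · -- in dimension `0`, all vectors are equal, and nothing is affected
      subst hn0
      have : cnt {x | x ∈ affStep A.1 θ '' Γ ∧ x - b ∉ affStep A.1 θ '' Γ} (box z L) = 0 := by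
        refine cnt_eq_zero ?_
        rintro y - ⟨h1, h2⟩
        exact h2 (by rwa [Subsingleton.elim (y - b) y])
      rw [this]; push_cast; positivity

theorem almostPer_gam (Q : OrthSeq n) (θ : ℕ → Fin n → ℝ) (k : ℕ) : AlmostPer (gam Q θ k) := by
  induction k with
  | zero => exact almostPer_univ
  | succ k ih => exact ih.image _ _

/-! ### Comparison of densities through Euclidean balls -/

/-- The Euclidean norm on `ℝⁿ`. -/
noncomputable def enrm (v : Fin n → ℝ) : ℝ := ‖(WithLp.toLp 2 v : EuclideanSpace ℝ (Fin n))‖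

theorem enrm_nonneg (v : Fin n → ℝ) : 0 ≤ enrm v := norm_nonneg _

theorem enrm_sq (v : Fin n → ℝ) : enrm v ^ 2 = v ⬝ᵥ v := by
  rw [enrm, EuclideanSpace.norm_sq_eq]
  simp [dotProduct, sq]

theorem enrm_add_le (v w : Fin n → ℝ) : enrm (v + w) ≤ enrm v + enrm w := by
  rw [enrm, WithLp.toLp_add]; exact norm_add_le _ _

theorem abs_le_enrm (v : Fin n → ℝ) (i : Fin n) : |v i| ≤ enrm v := by
  simpa [enrm] using PiLp.norm_apply_le (WithLp.toLp 2 v : EuclideanSpace ℝ (Fin n)) i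

theorem enrm_le_of_abs_le {v : Fin n → ℝ} {M : ℝ} (hM : 0 ≤ M) (h : ∀ i, |v i| ≤ M) :
    enrm v ≤ n * M := by
  refine le_of_sq_le_sq ?_ (by positivity)
  rw [enrm_sq, dotProduct]
  have h1 : ∑ i, v i * v i ≤ ∑ _i : Fin n, M ^ 2 := Finset.sum_le_sum fun i _ => by
    rw [← sq, ← sq_abs]
    exact pow_le_pow_left₀ (abs_nonneg _) (h i) 2
  have h2 : ∑ _i : Fin n, M ^ 2 = n * M ^ 2 := by simp
  have h3 : (n : ℝ) ≤ n ^ 2 := by exact_mod_cast Nat.le_self_pow two_ne_zero n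
  rw [h2] at h1
  nlinarith [sq_nonneg M]

theorem dotProduct_orth_mulVec (A : Matrix.orthogonalGroup (Fin n) ℝ) (v : Fin n → ℝ) :
    A.1.mulVec v ⬝ᵥ A.1.mulVec v = v ⬝ᵥ v := by
  rw [Matrix.dotProduct_mulVec, ← Matrix.mulVec_transpose, Matrix.mulVec_mulVec,
    orth_transpose_mul, Matrix.one_mulVec]

theorem enrm_orth_mulVec (A : Matrix.orthogonalGroup (Fin n) ℝ) (v : Fin n → ℝ) :
    enrm (A.1.mulVec v) = enrm v := by
  rw [← sq_eq_sq₀ (enrm_nonneg _) (enrm_nonneg _), enrm_sq, enrm_sq, dotProduct_orth_mulVec]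

open Classical in
/-- The integer points of the closed Euclidean ball of radius `R` centred at `0`. -/
noncomputable def eball (n : ℕ) (R : ℝ) : Finset (Fin n → ℤ) :=
  (Fintype.piFinset fun _ => Finset.Icc (-⌈R⌉) ⌈R⌉).filter fun x => enrm (castVec x) ≤ R

theorem mem_eball {R : ℝ} {x : Fin n → ℤ} : x ∈ eball n R ↔ enrm (castVec x) ≤ R := by
  classical
  simp only [eball, Finset.mem_filter, Fintype.mem_piFinset, Finset.mem_Icc, and_iff_right_iff_imp]
  intro h i
  have h1 := ((abs_le_enrm (castVec x) i).trans h).trans (Int.le_ceil R)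
  rw [castVec_apply] at h1
  exact abs_le.mp (by exact_mod_cast h1)

theorem eball_mono {R R' : ℝ} (h : R ≤ R') : eball n R ⊆ eball n R' := fun _ hx =>
  mem_eball.mpr ((mem_eball.mp hx).trans h)

theorem card_eball_pos {R : ℝ} (hR : 0 ≤ R) : 0 < (eball n R).card := by
  refine Finset.card_pos.mpr ⟨0, mem_eball.mpr ?_⟩
  have : castVec (0 : Fin n → ℤ) = 0 := by ext; simp
  rw [this, enrm, WithLp.toLp_zero, norm_zero]
  exact hR

theorem card_eball_le (n : ℕ) {R : ℝ} (hR : 0 ≤ R) :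
    ((eball n R).card : ℝ) ≤ (2 * R + 3) ^ n := by
  classical
  have h1 : (eball n R).card ≤ (2 * ⌈R⌉ + 1).toNat ^ n := by
    refine (Finset.card_filter_le _ _).trans (le_of_eq ?_)
    simp only [Fintype.card_piFinset, Int.card_Icc, Finset.prod_const, Finset.card_univ,
      Fintype.card_fin]
    congr 2
    ring
  have h2 : (((2 * ⌈R⌉ + 1).toNat : ℕ) : ℝ) ≤ 2 * R + 3 := by
    have h3 : (((2 * ⌈R⌉ + 1).toNat : ℕ) : ℤ) = 2 * ⌈R⌉ + 1 :=
      Int.toNat_of_nonneg (by have := Int.ceil_nonneg hR; omega)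
    have h4 : (((2 * ⌈R⌉ + 1).toNat : ℕ) : ℝ) = ((2 * ⌈R⌉ + 1 : ℤ) : ℝ) := by exact_mod_cast h3
    rw [h4]
    push_cast
    linarith [Int.ceil_lt_add_one R]
  calc ((eball n R).card : ℝ) ≤ (((2 * ⌈R⌉ + 1).toNat : ℕ) : ℝ) ^ n := by exact_mod_cast h1
    _ ≤ (2 * R + 3) ^ n := pow_le_pow_left₀ (by positivity) h2 n

/-- As the number of integer points of a ball grows polynomially with its radius, thickening a
suitable ball by a constant only adds a small proportion of points. -/
theorem exists_card_eball_le (n : ℕ) {C η : ℝ} (hC : 0 ≤ C) (hη : 0 < η) :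
    ∃ R ≥ 0, ((eball n (R + C)).card : ℝ) ≤ (1 + η) * (eball n R).card := by
  by_contra! h
  have h1 : ∀ j : ℕ, (1 + η) ^ j ≤ (eball n (j * C)).card := by
    intro j
    induction j with
    | zero =>
      have : 0 < (eball n 0).card := card_eball_pos le_rfl
      simp only [pow_zero, Nat.cast_zero, zero_mul]
      exact_mod_cast this
    | succ j ih =>
      have h2 := h (j * C) (by positivity)
      have h3 : ((j + 1 : ℕ) : ℝ) * C = j * C + C := by push_cast; ring
      rw [h3, pow_succ']
      exact (mul_le_mul_of_nonneg_left ih (by positivity)).trans h2.le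
  have h2 : ∀ j : ℕ, 1 ≤ j → (1 + η) ^ j ≤ (2 * C + 3) ^ n * (j : ℝ) ^ n := by
    intro j hj
    have hj' : (1 : ℝ) ≤ j := by exact_mod_cast hj
    refine (h1 j).trans ((card_eball_le n (by positivity)).trans ?_)
    rw [← mul_pow]
    exact pow_le_pow_left₀ (by positivity) (by nlinarith) n
  have h3 := tendsto_pow_const_div_const_pow_of_one_lt n (show 1 < 1 + η by linarith)
  have h4 : ∀ᶠ j : ℕ in atTop, (j : ℝ) ^ n / (1 + η) ^ j < 1 / (2 * C + 3) ^ n :=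
    h3.eventually_lt_const (by positivity)
  obtain ⟨j, hj, hj1⟩ := (h4.and (eventually_ge_atTop 1)).exists
  rw [div_lt_div_iff₀ (by positivity) (by positivity)] at hj
  have := h2 j hj1
  linarith

theorem cnt_eball_le {Γ : Set (Fin n → ℤ)} {L : ℕ} (hL : 0 < L) {s : ℝ}
    (h : ∀ z, (cnt Γ (box z L) : ℝ) ≤ s * L ^ n) (R : ℝ) :
    (cnt Γ (eball n R) : ℝ) ≤ s * (eball n (R + n * L)).card := by
  refine cnt_le_of_box hL h fun x hx z hz => ?_
  rw [mem_eball] at hx ⊢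
  rw [mem_box] at hz
  have h1 : castVec z = castVec x + castVec (z - x) := by rw [castVec_sub]; abel
  rw [h1]
  refine (enrm_add_le _ _).trans (add_le_add hx (enrm_le_of_abs_le (by positivity) fun i => ?_))
  have h2 : |z i - x i| ≤ L := by
    have := hz i
    rw [abs_le]
    omega
  simp only [castVec_apply, Pi.sub_apply]
  exact_mod_cast h2

/-- If `Γ` has density at most `s` and `Γ'` at least `t` at the scale `L`, and if in balls `Γ'` has
fewer points than `Γ`, up to a thickening and with a gain of a proportion `c` of points, then `t`
is at most `s - c`, up to an error due to the thickening. -/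
theorem density_add_le {Γ Γ' : Set (Fin n → ℤ)} {L : ℕ} (hL : 0 < L) {s t c C η R : ℝ}
    (hs0 : 0 ≤ s) (ht1 : t ≤ 1) (hR : 0 ≤ R)
    (hs : ∀ z, (cnt Γ (box z L) : ℝ) ≤ s * L ^ n)
    (ht : ∀ z, t * L ^ n ≤ cnt Γ' (box z L))
    (hC : 0 ≤ C)
    (hgrowth : ((eball n (R + (C + n * L))).card : ℝ) ≤ (1 + η) * (eball n R).card)
    (hcnt : (cnt Γ' (eball n R) : ℝ) + c * (eball n R).card ≤ cnt Γ (eball n (R + C))) :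
    t + c ≤ s + η * (s + 1 - t) := by
  have h1 := cnt_eball_le hL hs (R + C)
  rw [add_assoc] at h1
  have h2 : ∀ z, (cnt Γ'ᶜ (box z L) : ℝ) ≤ (1 - t) * L ^ n := fun z => by
    have e1 : (cnt Γ' (box z L) : ℝ) + cnt Γ'ᶜ (box z L) = L ^ n := by
      have := cnt_add_cnt_compl Γ' (box z L)
      rw [card_box] at this
      exact_mod_cast this
    linarith [ht z]
  have h3 := cnt_eball_le hL h2 R
  have h4 : (cnt Γ' (eball n R) : ℝ) + cnt Γ'ᶜ (eball n R) = (eball n R).card := by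
    exact_mod_cast cnt_add_cnt_compl Γ' (eball n R)
  have h5 : ((eball n (R + n * L)).card : ℝ) ≤ (eball n (R + (C + n * L))).card := by
    exact_mod_cast Finset.card_le_card (eball_mono (by linarith))
  have hN : (0 : ℝ) < (eball n R).card := by exact_mod_cast card_eball_pos hR
  have h6 := mul_le_mul_of_nonneg_left (h5.trans hgrowth) (sub_nonneg.mpr ht1)
  have h7 := mul_le_mul_of_nonneg_left hgrowth hs0
  have h8 : (t + c) * (eball n R).card ≤ (s + η * (s + 1 - t)) * (eball n R).card := by linarith
  exact le_of_mul_le_mul_right h8 hN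

theorem UDens.le_one {Γ : Set (Fin n → ℤ)} {D : ℝ} (h : UDens Γ D) : D ≤ 1 := by
  refine le_of_forall_pos_le_add fun η hη => ?_
  obtain ⟨L₀, hL₀⟩ := h η hη
  have h1 := (abs_le.mp (hL₀ (max L₀ 1) (le_max_left _ _) 0)).1
  have hp : (0 : ℝ) < ((max L₀ 1 : ℕ) : ℝ) ^ n := by
    have : 0 < max L₀ 1 := by omega
    positivity
  have h2 := cnt_box_div_le_one Γ 0 (max L₀ 1)
  rw [div_le_one hp] at h2
  nlinarith

/-- The Euclidean norm is almost preserved by the discretization of an affine isometry. -/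
theorem enrm_le_enrm_affStep (A : Matrix.orthogonalGroup (Fin n) ℝ) {θ : Fin n → ℝ} {K : ℝ}
    (hK : 0 ≤ K) (hθ : ∀ i, |θ i| ≤ K) (x : Fin n → ℤ) :
    enrm (castVec x) ≤ enrm (castVec (affStep A.1 θ x)) + n * (K + 1) := by
  rw [← enrm_orth_mulVec A]
  have h1 : A.1.mulVec (castVec x) = castVec (affStep A.1 θ x) +
      (A.1.mulVec (castVec x) - castVec (affStep A.1 θ x)) := by abel
  rw [h1]
  refine (enrm_add_le _ _).trans (add_le_add le_rfl
    (enrm_le_of_abs_le (by positivity) fun i => ?_))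
  have h2 := sub_half_le_p (A.1.mulVec (castVec x) i + θ i)
  have h3 := p_lt_add_half (A.1.mulVec (castVec x) i + θ i)
  have h4 := abs_le.mp (hθ i)
  simp only [Pi.sub_apply, castVec_apply, affStep, proj, Pi.add_apply]
  rw [abs_le]
  constructor <;> linarith [h4.1, h4.2]

/-- The density of the iterated images of `ℤⁿ` is nonincreasing. -/
theorem uDens_gam_succ_le {Q : OrthSeq n} {k : ℕ} {D D' : ℝ}
    (h : UDens (gam Q 0 k) D) (h' : UDens (gam Q 0 (k + 1)) D') : D' ≤ D := by
  have key : ∀ η > 0, η ≤ 1 → D' ≤ D + 6 * η := by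
    intro η hη hη1
    obtain ⟨L₁, hL₁⟩ := h η hη
    obtain ⟨L₂, hL₂⟩ := h' η hη
    set L := max (max L₁ L₂) 1
    have hLpos : 0 < L := by simp [L]
    obtain ⟨R, hR, hgrowth⟩ := exists_card_eball_le n (C := n * (0 + 1) + n * L) (by positivity) hη
    have hD0 := h.nonneg
    have hD1 := h'.le_one
    have hD0' := h'.nonneg
    have hD1' := h.le_one
    have := density_add_le (Γ := gam Q 0 k) (Γ' := gam Q 0 (k + 1)) hLpos (s := D + η)
      (t := D' - η) (c := 0) (C := n * (0 + 1)) (η := η) (R := R) (by linarith) (by linarith) hR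
      (fun z => by
        have := (abs_le.mp (hL₁ L ((le_max_left _ _).trans (le_max_left _ _)) z)).2
        linarith)
      (fun z => by
        have := (abs_le.mp (hL₂ L ((le_max_right _ _).trans (le_max_left _ _)) z)).1
        linarith) (by positivity) hgrowth ?_
    · nlinarith
    · rw [zero_mul, add_zero, Nat.cast_le]
      refine cnt_le_cnt_of_surj (affStep (Q k).1 0) ?_
      rintro _ hy ⟨x, hx, rfl⟩
      refine ⟨x, ?_, hx, rfl⟩
      rw [mem_eball] at hy ⊢
      exact (enrm_le_enrm_affStep (Q k) (θ := 0) (K := 0) le_rfl (by simp) x).trans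
        (add_le_add hy le_rfl)
  refine le_of_forall_pos_le_add fun ε hε => ?_
  refine (key (min (ε / 6) 1) (by positivity) (min_le_right _ _)).trans ?_
  linarith [min_le_left (ε / 6) 1]

/-- The uniform density of the `k`-th iterated image of `ℤⁿ`. -/
theorem uDens_rate (Q : OrthSeq n) (k : ℕ) : UDens (gam Q 0 k) (rate Q k) := by
  obtain ⟨D, hD⟩ := (almostPer_gam Q 0 k).exists_uDens
  rwa [rate, range_iter_eq_gam, hD.upperDensity_eq]

theorem rate_antitone (Q : OrthSeq n) : Antitone (rate Q) :=
  antitone_nat_of_succ_le fun k => uDens_gam_succ_le (uDens_rate Q k) (uDens_rate Q (k + 1))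

theorem rate_nonneg (Q : OrthSeq n) (k : ℕ) : 0 ≤ rate Q k := (uDens_rate Q k).nonneg

theorem hasAsymptoticRate_iInf (Q : OrthSeq n) : HasAsymptoticRate Q (⨅ k, rate Q k) :=
  tendsto_atTop_ciInf (rate_antitone Q) ⟨0, by rintro _ ⟨k, rfl⟩; exact rate_nonneg Q k⟩

/-! ### The space of sequences of orthogonal matrices -/

section Metric

attribute [local instance] Matrix.normedAddCommGroup

theorem abs_sub_le_dist (P Q : OrthSeq n) (k : ℕ) (i j : Fin n) :
    |(P k).1 i j - (Q k).1 i j| ≤ dist P Q := by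
  have h1 : ‖(P k).1 - (Q k).1‖ ≤ dist P Q := le_ciSup (bddAbove_dist P Q) k
  have h2 := Matrix.norm_entry_le_entrywise_sup_norm ((P k).1 - (Q k).1) (i := i) (j := j)
  simpa using h2.trans h1

theorem orthSeq_dist_le {P Q : OrthSeq n} {δ : ℝ} (hδ : 0 ≤ δ)
    (h : ∀ k i j, |(P k).1 i j - (Q k).1 i j| ≤ δ) : dist P Q ≤ δ := by
  refine ciSup_le fun k => ?_
  rw [Matrix.norm_le_iff hδ]
  exact fun i j => by simpa using h k i j

end Metric

theorem continuous_orthSeq_entry (k : ℕ) (i j : Fin n) :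
    Continuous fun Q : OrthSeq n => (Q k).1 i j := by
  refine (LipschitzWith.of_dist_le_mul (K := 1) fun P Q => ?_).continuous
  rw [Real.dist_eq]
  simpa using abs_sub_le_dist P Q k i j

theorem continuous_orthSeq_eval (k : ℕ) : Continuous fun Q : OrthSeq n => (Q k).1 :=
  continuous_matrix fun i j => continuous_orthSeq_entry k i j

theorem isClosed_orthogonalGroup :
    IsClosed (Matrix.orthogonalGroup (Fin n) ℝ : Set (Matrix (Fin n) (Fin n) ℝ)) := by
  have : (Matrix.orthogonalGroup (Fin n) ℝ : Set (Matrix (Fin n) (Fin n) ℝ)) =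
      {A | A * A.transpose = 1} := by
    ext A
    exact Matrix.mem_orthogonalGroup_iff _ _
  rw [this]
  exact isClosed_eq (by fun_prop) continuous_const

instance compactSpace_orthogonalGroup : CompactSpace (Matrix.orthogonalGroup (Fin n) ℝ) := by
  refine isCompact_iff_compactSpace.mp ?_
  have h : IsCompact (Set.univ.pi fun _ : Fin n => Set.univ.pi fun _ : Fin n =>
      Set.Icc (-1 : ℝ) 1) :=
    isCompact_univ_pi fun _ => isCompact_univ_pi fun _ => isCompact_Icc
  refine h.of_isClosed_subset isClosed_orthogonalGroup fun A hA => ?_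
  exact fun i _ j _ => abs_le.mp (abs_orth_apply_le ⟨A, hA⟩ i j)

instance completeSpace_orthSeq : CompleteSpace (OrthSeq n) := by
  refine Metric.complete_of_cauchySeq_tendsto fun u hu => ?_
  have hcau : ∀ k i j, CauchySeq fun m => (u m k).1 i j := fun k i j => by
    rw [Metric.cauchySeq_iff] at hu ⊢
    intro ε hε
    obtain ⟨N, hN⟩ := hu ε hε
    exact ⟨N, fun a ha b hb => (abs_sub_le_dist (u a) (u b) k i j).trans_lt (hN a ha b hb)⟩
  choose B hB using fun k i j => cauchySeq_tendsto_of_complete (hcau k i j)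
  have hmem : ∀ k, Matrix.of (B k) ∈ Matrix.orthogonalGroup (Fin n) ℝ := fun k => by
    refine isClosed_orthogonalGroup.mem_of_tendsto (f := fun m => (u m k).1) (b := atTop) ?_
      (Eventually.of_forall fun m => (u m k).2)
    exact tendsto_pi_nhds.mpr fun i => tendsto_pi_nhds.mpr fun j => hB k i j
  obtain ⟨S, hS⟩ : ∃ S : OrthSeq n, ∀ k i j, (S k).1 i j = B k i j :=
    ⟨fun k => ⟨Matrix.of (B k), hmem k⟩, fun _ _ _ => rfl⟩
  refine ⟨S, ?_⟩
  rw [Metric.tendsto_atTop]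
  intro ε hε
  obtain ⟨N, hN⟩ := Metric.cauchySeq_iff.mp hu (ε / 2) (half_pos hε)
  refine ⟨N, fun m hm => lt_of_le_of_lt (orthSeq_dist_le (half_pos hε).le fun k i j => ?_)
    (half_lt_self hε)⟩
  have h1 : Tendsto (fun m' => |(u m k).1 i j - (u m' k).1 i j|) atTop
      (𝓝 |(u m k).1 i j - (S k).1 i j|) := by
    rw [hS]; exact (tendsto_const_nhds.sub (hB k i j)).abs
  refine le_of_tendsto h1 ?_
  filter_upwards [eventually_ge_atTop N] with m' hm'
  exact (abs_sub_le_dist (u m) (u m') k i j).trans (hN m hm m' hm').le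

/-! ### Small rotations -/

/-- The rotation of angle `t` in the plane of the coordinates `i` and `j`. -/
noncomputable def planeRot (i j : Fin n) (t : ℝ) : Matrix (Fin n) (Fin n) ℝ :=
  1 + (Real.cos t - 1) • (Matrix.single i i 1 + Matrix.single j j 1) +
    Real.sin t • (Matrix.single j i 1 - Matrix.single i j 1)

theorem planeRot_mem {i j : Fin n} (hij : i ≠ j) (t : ℝ) :
    planeRot i j t ∈ Matrix.orthogonalGroup (Fin n) ℝ := by
  rw [Matrix.mem_orthogonalGroup_iff]
  set E : Matrix (Fin n) (Fin n) ℝ := Matrix.single i i 1 + Matrix.single j j 1 with hE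
  set J : Matrix (Fin n) (Fin n) ℝ := Matrix.single j i 1 - Matrix.single i j 1 with hJ
  have hEE : E * E = E := by simp [hE, mul_add, add_mul, hij, hij.symm]
  have hEJ : E * J = J := by simp [hE, hJ, mul_sub, add_mul, hij, hij.symm]
  have hJE : J * E = J := by simp [hE, hJ, sub_mul, mul_add, hij, hij.symm]; abel
  have hJJ : J * J = -E := by simp [hE, hJ, sub_mul, mul_sub, hij, hij.symm]; abel
  have hT : (planeRot i j t).transpose = 1 + (Real.cos t - 1) • E - Real.sin t • J := by
    simp only [planeRot, hE, hJ, Matrix.transpose_add, Matrix.transpose_smul,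
      Matrix.transpose_sub, Matrix.transpose_one, Matrix.transpose_single]
    module
  rw [hT, planeRot]
  change (1 + (Real.cos t - 1) • E + Real.sin t • J) * _ = 1
  simp only [mul_add, mul_sub, add_mul, one_mul, mul_one, smul_mul_assoc, mul_smul_comm, hEE, hEJ,
    hJE, hJJ, smul_neg]
  match_scalars <;> first | ring1 | linear_combination Real.sin_sq_add_cos_sq t

theorem planeRot_mulVec_apply {i j : Fin n} (hij : i ≠ j) (t : ℝ) (w : Fin n → ℝ) :
    (planeRot i j t).mulVec w i = Real.cos t * w i - Real.sin t * w j := by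
  simp [planeRot, Matrix.add_mulVec, Matrix.sub_mulVec, Matrix.smul_mulVec,
    Matrix.single_mulVec, hij]
  ring

/-- Arbitrarily small rotations change a given coordinate of a given nonzero vector. -/
theorem exists_rot_ne (hn : 2 ≤ n) {w : Fin n → ℝ} (hw : w ≠ 0) (i : Fin n)
    {U : Set (Matrix.orthogonalGroup (Fin n) ℝ)} (hU : U ∈ 𝓝 1) :
    ∃ R ∈ U, R.1.mulVec w i ≠ w i := by
  obtain ⟨j, hij, hj⟩ : ∃ j, i ≠ j ∧ (w i ≠ 0 ∨ w j ≠ 0) := by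
    by_cases hi : w i = 0
    · obtain ⟨j, hj⟩ := Function.ne_iff.mp hw
      exact ⟨j, fun h => hj (by simpa [h] using hi), Or.inr hj⟩
    · have : Nontrivial (Fin n) := Fin.nontrivial_iff_two_le.mpr hn
      obtain ⟨j, hj⟩ := exists_ne i
      exact ⟨j, hj.symm, Or.inl hi⟩
  set r : ℝ → Matrix.orthogonalGroup (Fin n) ℝ := fun t => ⟨planeRot i j t, planeRot_mem hij t⟩
    with hr
  have hcont : Continuous r := by
    refine Continuous.subtype_mk ?_ _
    unfold planeRot
    fun_prop
  have hr0 : r 0 = 1 := by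
    apply Subtype.ext
    simp [hr, planeRot]
  have hev : ∀ᶠ t in 𝓝 (0 : ℝ), r t ∈ U := hcont.continuousAt (by rwa [hr0])
  obtain ⟨δ, hδ, hball⟩ := Metric.eventually_nhds_iff.mp hev
  set t := min (δ / 2) 1 with ht
  have ht0 : 0 < t := by positivity
  have htδ : t < δ := (min_le_left _ _).trans_lt (half_lt_self hδ)
  have ht1 : t ≤ 1 := min_le_right _ _
  have h1 : r t ∈ U := hball (by simpa [abs_of_pos ht0] using htδ)
  have h2 : r (-t) ∈ U := hball (by simpa [abs_of_pos ht0] using htδ)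
  by_contra! h
  have e1 := h _ h1
  have e2 := h _ h2
  simp only [hr, planeRot_mulVec_apply hij, Real.cos_neg, Real.sin_neg] at e1 e2
  have hs : 0 < Real.sin t := Real.sin_pos_of_pos_of_lt_pi ht0 (by linarith [Real.pi_gt_three])
  have hc : Real.cos t ≠ 1 := by
    intro hc
    have := Real.sin_sq_add_cos_sq t
    rw [hc] at this
    nlinarith
  rcases hj with hj | hj
  · have : (Real.cos t - 1) * w i = 0 := by linarith
    rcases mul_eq_zero.mp this with h | h
    · exact hc (by linarith)
    · exact hj h
  · have : Real.sin t * w j = 0 := by linarith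
    rcases mul_eq_zero.mp this with h | h
    · exact hs.ne' h
    · exact hj h

/-! ### Generic sequences -/

theorem isOpen_ne_int : IsOpen {x : ℝ | ∀ b : ℤ, x ≠ b} := by
  have : {x : ℝ | ∀ b : ℤ, x ≠ b} = (Set.range ((↑) : ℤ → ℝ))ᶜ := by
    ext x; simp [eq_comm]
  rw [this]
  exact Int.isClosedEmbedding_coe_real.isClosed_range.isOpen_compl

theorem castVec_ne_zero {u : Fin n → ℤ} (hu : u ≠ 0) : castVec u ≠ 0 := fun h => hu <| by
  funext i
  have := congrFun h i
  simpa using this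

theorem orth_mulVec_ne_zero (A : Matrix.orthogonalGroup (Fin n) ℝ) {v : Fin n → ℝ} (hv : v ≠ 0) :
    A.1.mulVec v ≠ 0 := fun h => hv <| by
  have := congrArg (A.1.transpose.mulVec) h
  rwa [Matrix.mulVec_mulVec, orth_transpose_mul, Matrix.one_mulVec, Matrix.mulVec_zero] at this

theorem isOpen_mulVec_ne_int (u : Fin n → ℝ) (i : Fin n) :
    IsOpen {A : Matrix.orthogonalGroup (Fin n) ℝ | ∀ b : ℤ, A.1.mulVec u i ≠ b} :=
  isOpen_ne_int.preimage (by fun_prop : Continuous fun A : Matrix.orthogonalGroup (Fin n) ℝ =>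
    A.1.mulVec u i)

theorem dense_mulVec_ne_int (hn : 2 ≤ n) {u : Fin n → ℝ} (hu : u ≠ 0) (i : Fin n) :
    Dense {A : Matrix.orthogonalGroup (Fin n) ℝ | ∀ b : ℤ, A.1.mulVec u i ≠ b} := by
  intro A
  rw [mem_closure_iff_nhds]
  intro U hU
  by_cases h : ∀ b : ℤ, A.1.mulVec u i ≠ b
  · exact ⟨A, mem_of_mem_nhds hU, h⟩
  push Not at h
  obtain ⟨b, hb⟩ := h
  have hcont : Continuous fun R : Matrix.orthogonalGroup (Fin n) ℝ => R * A :=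
    Continuous.subtype_mk (by fun_prop) _
  have h1 : ∀ᶠ R in 𝓝 (1 : Matrix.orthogonalGroup (Fin n) ℝ), R * A ∈ U :=
    hcont.continuousAt (by simpa using hU)
  have hcont2 : Continuous fun R : Matrix.orthogonalGroup (Fin n) ℝ =>
      |R.1.mulVec (A.1.mulVec u) i - (b : ℝ)| := by fun_prop
  have h2 : ∀ᶠ R in 𝓝 (1 : Matrix.orthogonalGroup (Fin n) ℝ),
      |R.1.mulVec (A.1.mulVec u) i - (b : ℝ)| < 1 :=
    hcont2.continuousAt.eventually_lt_const (by simp [hb])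
  obtain ⟨R, ⟨hR1, hR2⟩, hR⟩ := exists_rot_ne hn (orth_mulVec_ne_zero A hu) i (h1.and h2)
  refine ⟨R * A, hR1, fun b' hb' => ?_⟩
  have hb'' : R.1.mulVec (A.1.mulVec u) i = b' := by
    rw [Matrix.mulVec_mulVec]; exact hb'
  rw [hb''] at hR2 hR
  rw [hb] at hR
  apply hR
  have : |b' - b| < 1 := by exact_mod_cast hR2
  rw [Int.abs_lt_one_iff] at this
  rw [sub_eq_zero.mp this]

/-- The sequences of matrices `A` such that, for nonzero integer vectors `u` with coordinates at
most `ℓ`, the coordinates of `A u` stay away from the integers, uniformly along the sequence. -/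
def gapSet (n ℓ : ℕ) : Set (OrthSeq n) :=
  {Q | ∃ c > 0, ∀ j, ∀ u : Fin n → ℤ, u ≠ 0 → (∀ i, |u i| ≤ ℓ) → ∀ i, ∀ b : ℤ,
    c ≤ |(Q j).1.mulVec (castVec u) i - b|}

theorem isOpen_gapSet (n ℓ : ℕ) : IsOpen (gapSet n ℓ) := by
  rw [Metric.isOpen_iff]
  rintro Q ⟨c, hc, h⟩
  refine ⟨c / (2 * (n * ℓ + 1)), by positivity, fun Q' hQ' => ⟨c / 2, half_pos hc, ?_⟩⟩
  intro j u hu hul i b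
  have h1 := h j u hu hul i b
  have h2 := abs_mulVec_le (A := (Q j).1 - (Q' j).1) (a := c / (2 * (n * ℓ + 1)))
    (v := castVec u) (M := ℓ) (fun i j' => by
      rw [Matrix.sub_apply]
      refine (abs_sub_le_dist Q Q' j i j').trans ?_
      rw [dist_comm]
      exact (Metric.mem_ball.mp hQ').le) (fun i => by
      rw [castVec_apply]; exact_mod_cast hul i) i
  rw [Matrix.sub_mulVec, Pi.sub_apply] at h2
  have h3 : (n : ℝ) * (c / (2 * (n * ℓ + 1)) * ℓ) ≤ c / 2 := by
    rw [show (n : ℝ) * (c / (2 * (n * ℓ + 1)) * ℓ) = (c * (n * ℓ)) / (2 * (n * ℓ + 1)) by ring,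
      div_le_div_iff₀ (by positivity) (by positivity)]
    nlinarith
  have h4 := abs_sub_le ((Q j).1.mulVec (castVec u) i) ((Q' j).1.mulVec (castVec u) i) b
  linarith

/-- By compactness of the orthogonal group, the terms of a sequence can be approximated by elements
of a finite set of matrices without integrality relations; this provides a uniform gap. -/
theorem dense_gapSet (hn : 2 ≤ n) (ℓ : ℕ) : Dense (gapSet n ℓ) := by
  classical
  set us : Finset (Fin n → ℤ) :=
    (Fintype.piFinset fun _ => Finset.Icc (-ℓ : ℤ) ℓ).erase 0 with hus
  set W : Set (Matrix.orthogonalGroup (Fin n) ℝ) := ⋂ x : {u : Fin n → ℤ // u ≠ 0} × Fin n,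
    {A | ∀ b : ℤ, A.1.mulVec (castVec x.1.1) x.2 ≠ b} with hW
  have hWd : Dense W := dense_iInter_of_isOpen (fun x => isOpen_mulVec_ne_int _ _)
    fun x => dense_mulVec_ne_int hn (castVec_ne_zero x.1.2) _
  rw [Metric.dense_iff]
  intro P r hr
  have hcover : (Set.univ : Set (Matrix.orthogonalGroup (Fin n) ℝ)) ⊆
      ⋃ A : W, {B | ∀ i j, |A.1.1 i j - B.1 i j| < r / 2} := by
    intro B _
    have hop : IsOpen {A : Matrix.orthogonalGroup (Fin n) ℝ |
        ∀ i j, |A.1 i j - B.1 i j| < r / 2} := by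
      simp only [Set.ofPred_forall]
      exact isOpen_iInter_of_finite fun i => isOpen_iInter_of_finite fun j =>
        isOpen_lt ((continuous_subtype_val.matrix_elem i j).sub continuous_const).abs
          continuous_const
    obtain ⟨A, hA1, hA2⟩ := hWd.inter_open_nonempty _ hop ⟨B, by simp [hr]⟩
    exact Set.mem_iUnion.mpr ⟨⟨A, hA2⟩, hA1⟩
  obtain ⟨t, ht⟩ := isCompact_univ.elim_finite_subcover _ (fun A => by
    simp only [Set.ofPred_forall]
    exact isOpen_iInter_of_finite fun i => isOpen_iInter_of_finite fun j =>
      isOpen_lt (continuous_const.sub (continuous_subtype_val.matrix_elem i j)).abs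
        continuous_const) hcover
  have hch : ∀ k, ∃ A ∈ t, ∀ i j, |A.1.1 i j - (P k).1 i j| < r / 2 := fun k => by
    have := ht (Set.mem_univ (P k))
    simpa using this
  choose A hAt hAP using hch
  obtain ⟨c, hc, hcle⟩ := exists_pos_forall_le (t ×ˢ us ×ˢ (Finset.univ : Finset (Fin n)))
    (fun x => |x.1.1.1.mulVec (castVec x.2.1) x.2.2 - round (x.1.1.1.mulVec (castVec x.2.1) x.2.2)|)
    (fun x hx => by
      rw [abs_pos, sub_ne_zero]
      simp only [Finset.mem_product, hus, Finset.mem_erase] at hx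
      exact Set.mem_iInter.mp x.1.2 (⟨x.2.1, hx.2.1.1⟩, x.2.2) _)
  refine ⟨fun k => (A k).1, ?_, c, hc, fun j u hu hul i b => ?_⟩
  · exact (orthSeq_dist_le (half_pos hr).le fun k i j => (hAP k i j).le).trans_lt
      (half_lt_self hr)
  · refine (hcle (A j, u, i) ?_).trans (round_le _ _)
    simp only [Finset.mem_product, Finset.mem_univ, and_true, hus, Finset.mem_erase,
      Fintype.mem_piFinset, Finset.mem_Icc]
    exact ⟨hAt j, hu, fun i => abs_le.mp (hul i)⟩

/-- The product of the first `k` matrices of a sequence. -/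
noncomputable def prodMat (Q : OrthSeq n) : ℕ → Matrix (Fin n) (Fin n) ℝ
  | 0 => 1
  | k + 1 => (Q k).1 * prodMat Q k

/-- The linear form on `ℤⁿ` obtained by composing `x ↦ (Q₀ x, Q₁ Q₀ x, …)` with the integer
linear form `m`. -/
noncomputable def charVec (Q : OrthSeq n) {k : ℕ} (m : Fin k → Fin n → ℤ) : Fin n → ℝ :=
  ∑ j, Matrix.vecMul (castVec (m j)) (prodMat Q (j + 1))

/-- The sequences for which the linear form `charVec Q m` is not integral. -/
def irrSet (n : ℕ) {k : ℕ} (m : Fin k → Fin n → ℤ) : Set (OrthSeq n) :=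
  {Q | ∃ i, ∀ b : ℤ, charVec Q m i ≠ b}

theorem continuous_prodMat (k : ℕ) : Continuous fun Q : OrthSeq n => prodMat Q k := by
  induction k with
  | zero => exact continuous_const
  | succ k ih => exact (continuous_orthSeq_eval k).matrix_mul ih

theorem continuous_charVec {k : ℕ} (m : Fin k → Fin n → ℤ) :
    Continuous fun Q : OrthSeq n => charVec Q m := by
  unfold charVec
  exact continuous_finsetSum _ fun j _ => continuous_const.matrix_vecMul (continuous_prodMat _)

theorem isOpen_irrSet {k : ℕ} (m : Fin k → Fin n → ℤ) : IsOpen (irrSet n m) := by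
  have : irrSet n m = ⋃ i, (fun Q => charVec Q m i) ⁻¹' {x : ℝ | ∀ b : ℤ, x ≠ b} := by
    ext Q; simp [irrSet]
  rw [this]
  exact isOpen_iUnion fun i =>
    isOpen_ne_int.preimage ((continuous_apply i).comp (continuous_charVec m))

theorem prodMat_congr {Q Q' : OrthSeq n} {k : ℕ} (h : ∀ j < k, Q j = Q' j) :
    prodMat Q k = prodMat Q' k := by
  induction k with
  | zero => rfl
  | succ k ih => rw [prodMat, prodMat, ih fun j hj => h j (by omega), h k (by omega)]

theorem prodMat_mul_transpose (Q : OrthSeq n) (k : ℕ) :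
    prodMat Q k * (prodMat Q k).transpose = 1 := by
  induction k with
  | zero => simp [prodMat]
  | succ k ih =>
    rw [prodMat, Matrix.transpose_mul, Matrix.mul_assoc, ← Matrix.mul_assoc (prodMat Q k), ih,
      Matrix.one_mul, orth_mul_transpose]

/-- The integrality of `charVec Q m` is destroyed by a small rotation of the matrix `Q j`, where
`j` is the last index such that `m j ≠ 0`. -/
theorem dense_irrSet (hn : 2 ≤ n) {k : ℕ} {m : Fin k → Fin n → ℤ} (hm : m ≠ 0) :
    Dense (irrSet n m) := by
  classical
  intro Q
  rw [mem_closure_iff_nhds]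
  intro U hU
  by_cases hQ : Q ∈ irrSet n m
  · exact ⟨Q, mem_of_mem_nhds hU, hQ⟩
  simp only [irrSet, Set.mem_ofPred_eq, not_exists, not_forall, not_not] at hQ
  obtain ⟨j, hj, hlast⟩ : ∃ j, m j ≠ 0 ∧ ∀ j' > j, m j' = 0 := by
    have hne : (Finset.univ.filter fun j => m j ≠ 0).Nonempty := by
      obtain ⟨j, hj⟩ := Function.ne_iff.mp hm
      exact ⟨j, by simpa using hj⟩
    refine ⟨_, (Finset.mem_filter.mp (Finset.max'_mem _ hne)).2, fun j' hj' => ?_⟩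
    by_contra h
    exact absurd (Finset.le_max' _ j' (by simpa using h)) (not_le.mpr hj')
  set v : Fin n → ℝ := (Q j).1.transpose.mulVec (castVec (m j)) with hv
  have hv0 : v ≠ 0 := fun h => by
    have := congrArg (Q j).1.mulVec h
    rw [hv, Matrix.mulVec_mulVec, orth_mul_transpose, Matrix.one_mulVec, Matrix.mulVec_zero]
      at this
    exact castVec_ne_zero hj this
  -- the perturbed sequence, as a function of the rotation
  set F : Matrix.orthogonalGroup (Fin n) ℝ → OrthSeq n := fun R =>
    Function.update Q j (Q j * ⟨R.1.transpose, by
      rw [Matrix.mem_orthogonalGroup_iff, Matrix.transpose_transpose]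
      exact orth_transpose_mul R⟩) with hF
  have hFj : ∀ R, (F R j).1 = (Q j).1 * R.1.transpose := fun R =>
    congrArg Subtype.val (Function.update_self
      (β := fun _ : ℕ => Matrix.orthogonalGroup (Fin n) ℝ) (j : ℕ) _ Q)
  have hFne : ∀ R, ∀ j' : ℕ, j' ≠ j → F R j' = Q j' := fun R j' h => by
    simp only [hF]; exact Function.update_of_ne h _ _
  have hF1 : F 1 = Q := by
    funext j'
    by_cases h : j' = j
    · subst h; apply Subtype.ext; rw [hFj]; simp
    · exact hFne 1 j' h
  have hFcont : ContinuousAt F 1 := by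
    rw [Metric.continuousAt_iff']
    intro ε hε
    have hc : ∀ i i', ∀ᶠ R in 𝓝 (1 : Matrix.orthogonalGroup (Fin n) ℝ),
        |((Q j).1 * R.1.transpose) i i' - (Q j).1 i i'| < ε / 2 := fun i i' => by
      have : Continuous fun R : Matrix.orthogonalGroup (Fin n) ℝ =>
          |((Q j).1 * R.1.transpose) i i' - (Q j).1 i i'| := by fun_prop
      exact this.continuousAt.eventually_lt_const (by simp [hε])
    filter_upwards [eventually_all.mpr fun i => eventually_all.mpr fun i' => hc i i'] with R hR
    rw [hF1]
    refine (orthSeq_dist_le (half_pos hε).le fun j' i i' => ?_).trans_lt (half_lt_self hε)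
    by_cases h : j' = j
    · subst h; rw [hFj]; exact (hR i i').le
    · rw [hFne R j' h, sub_self, abs_zero]; positivity
  -- only the term of index `j` depends on the rotation
  have hchar : ∀ R, charVec (F R) m =
      charVec Q m + (prodMat Q j).transpose.mulVec (R.1.mulVec v - v) := by
    intro R
    rw [← sub_eq_iff_eq_add', charVec, charVec, ← Finset.sum_sub_distrib,
      Finset.sum_eq_single j]
    · rw [prodMat, prodMat, hFj, prodMat_congr (Q := F R) (Q' := Q) fun j' hj' =>
        hFne R j' (by omega)]
      rw [Matrix.mulVec_sub, hv, ← Matrix.vecMul_transpose, ← Matrix.vecMul_transpose,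
        ← Matrix.vecMul_transpose, Matrix.vecMul_vecMul, ← Matrix.vecMul_transpose,
        Matrix.transpose_transpose, Matrix.transpose_transpose, Matrix.vecMul_vecMul,
        Matrix.vecMul_vecMul, Matrix.mul_assoc]
    · intro j' _ hne
      rcases lt_or_gt_of_ne hne with h | h
      · rw [prodMat_congr (Q := F R) (Q' := Q) fun j'' hj'' => hFne R j'' (by
          have : (j' : ℕ) < j := h
          omega), sub_self]
      · rw [hlast j' h]
        have : castVec (0 : Fin n → ℤ) = 0 := by ext; simp
        simp [this]
    · simp
  have hU' : ∀ᶠ R in 𝓝 (1 : Matrix.orthogonalGroup (Fin n) ℝ), F R ∈ U :=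
    hFcont (by rwa [hF1])
  have hclose : ∀ i, ∀ᶠ R in 𝓝 (1 : Matrix.orthogonalGroup (Fin n) ℝ),
      |(prodMat Q j).transpose.mulVec (R.1.mulVec v - v) i| < 1 := fun i => by
    have : Continuous fun R : Matrix.orthogonalGroup (Fin n) ℝ =>
      |(prodMat Q j).transpose.mulVec (R.1.mulVec v - v) i| := by fun_prop
    exact this.continuousAt.eventually_lt_const (by simp)
  have : Nonempty (Fin n) := ⟨⟨0, by omega⟩⟩
  obtain ⟨R, ⟨hR1, hR2⟩, hR⟩ := exists_rot_ne hn hv0 (Classical.arbitrary _)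
    (hU'.and (eventually_all.mpr hclose))
  refine ⟨F R, hR1, ?_⟩
  have hne : (prodMat Q j).transpose.mulVec (R.1.mulVec v - v) ≠ 0 := fun h => by
    have := congrArg (prodMat Q j).mulVec h
    rw [Matrix.mulVec_mulVec, prodMat_mul_transpose, Matrix.one_mulVec, Matrix.mulVec_zero,
      sub_eq_zero] at this
    exact hR (congrFun this _)
  obtain ⟨i, hi⟩ := Function.ne_iff.mp hne
  refine ⟨i, fun b hb => ?_⟩
  obtain ⟨b', hb'⟩ := hQ i
  have h1 := hR2 i
  rw [hchar, Pi.add_apply, hb'] at hb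
  have h2 : (prodMat Q j).transpose.mulVec (R.1.mulVec v - v) i = ((b - b' : ℤ) : ℝ) := by
    push_cast; linarith
  rw [h2] at h1 hi
  have h3 : |b - b'| < 1 := by exact_mod_cast h1
  rw [Int.abs_lt_one_iff] at h3
  simp [h3] at hi

/-- The generic sequences: for all `ℓ`, nonzero integer vectors of size at most `ℓ` are mapped to
vectors whose coordinates stay away from the integers, uniformly along the sequence; and no
nontrivial integer combination `charVec Q m` is integral. -/
def genericSet (n : ℕ) : Set (OrthSeq n) :=
  (⋂ ℓ : ℕ, gapSet n ℓ) ∩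
    ⋂ m : Σ k : ℕ, {m : Fin k → Fin n → ℤ // m ≠ 0}, irrSet n m.2.1

theorem isGδ_genericSet (n : ℕ) : IsGδ (genericSet n) :=
  (IsGδ.iInter_of_isOpen fun ℓ => isOpen_gapSet n ℓ).inter
    (IsGδ.iInter_of_isOpen fun _ => isOpen_irrSet _)

theorem dense_genericSet (hn : 2 ≤ n) : Dense (genericSet n) := by
  refine Dense.inter_of_Gδ (IsGδ.iInter_of_isOpen fun ℓ => isOpen_gapSet n ℓ)
    (IsGδ.iInter_of_isOpen fun _ => isOpen_irrSet _) ?_ ?_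
  · exact dense_iInter_of_isOpen (fun ℓ => isOpen_gapSet n ℓ) fun ℓ => dense_gapSet hn ℓ
  · exact dense_iInter_of_isOpen (fun _ => isOpen_irrSet _) fun m => dense_irrSet hn m.2.2

/-! ### Kronecker's theorem -/

open MeasureTheory in
/-- A nontrivial character of a compact group has integral zero. -/
theorem integral_char_eq_zero {G : Type*} [AddCommGroup G] [MeasurableSpace G] [MeasurableAdd G]
    (μ : Measure G) [μ.IsAddLeftInvariant] {χ : G → ℂ}
    (hχ : ∀ g h, χ (g + h) = χ g * χ h) {g : G} (hg : χ g ≠ 1) : ∫ h, χ h ∂μ = 0 := by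
  have h1 := integral_add_left_eq_self (μ := μ) χ g
  simp only [hχ, integral_const_mul] at h1
  have h2 : (χ g - 1) * ∫ h, χ h ∂μ = 0 := by rw [sub_mul, h1]; ring
  exact (mul_eq_zero.mp h2).resolve_left (sub_ne_zero.mpr hg)

theorem mFourier_map_add {d : Type*} [Fintype d] (m : d → ℤ) (x y : UnitAddTorus d) :
    UnitAddTorus.mFourier m (x + y) = UnitAddTorus.mFourier m x * UnitAddTorus.mFourier m y := by
  simp only [UnitAddTorus.mFourier, ContinuousMap.coe_mk, Pi.add_apply, ← Finset.prod_mul_distrib]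
  refine Finset.prod_congr rfl fun i _ => ?_
  simp [fourier_apply, smul_add, AddCircle.toCircle_add]

open MeasureTheory in
/-- A closed subgroup of a torus on which no nontrivial character is trivial is the whole torus:
its Haar measure and the one of the torus have the same integrals on characters, hence on all
continuous functions. -/
theorem eq_top_of_mFourier_ne_one {d : Type*} [Fintype d] (H : AddSubgroup (UnitAddTorus d))
    (hH : IsClosed (H : Set (UnitAddTorus d)))
    (h : ∀ m : d → ℤ, m ≠ 0 → ∃ x ∈ H, UnitAddTorus.mFourier m x ≠ 1) : H = ⊤ := by
  have hcomp : CompactSpace H := isCompact_iff_compactSpace.mp hH.isCompact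
  let μ : Measure H := Measure.addHaarMeasure ⊤
  have hμ : μ Set.univ = 1 :=
    Measure.addHaarMeasure_self (K₀ := (⊤ : TopologicalSpace.PositiveCompacts H))
  have hμp : IsProbabilityMeasure μ := ⟨hμ⟩
  let ν : Measure (UnitAddTorus d) := Measure.addHaarMeasure ⊤
  have hν : ν Set.univ = 1 :=
    Measure.addHaarMeasure_self (K₀ := (⊤ : TopologicalSpace.PositiveCompacts (UnitAddTorus d)))
  have hνp : IsProbabilityMeasure ν := ⟨hν⟩
  have hintμ : ∀ f : C(UnitAddTorus d, ℂ), Integrable (fun x : H => f x) μ := fun f =>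
    (f.continuous.comp continuous_subtype_val).integrable_of_hasCompactSupport
      (HasCompactSupport.of_compactSpace _)
  have hintν : ∀ f : C(UnitAddTorus d, ℂ), Integrable (fun x => f x) ν := fun f =>
    f.continuous.integrable_of_hasCompactSupport (HasCompactSupport.of_compactSpace _)
  have hspan : ∀ f ∈ Submodule.span ℂ (Set.range (UnitAddTorus.mFourier (d := d))),
      ∫ x : H, f x ∂μ = ∫ x, f x ∂ν := by
    intro f hf
    induction hf using Submodule.span_induction with
    | mem f hf =>
      obtain ⟨m, rfl⟩ := hf
      by_cases hm : m = 0
      · subst hm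
        simp [UnitAddTorus.mFourier_zero]
      · obtain ⟨x, hx, hne⟩ := h m hm
        rw [integral_char_eq_zero ν (mFourier_map_add m) hne,
          integral_char_eq_zero μ (χ := fun x : H => UnitAddTorus.mFourier m x)
            (fun x y => mFourier_map_add m x y) (g := ⟨x, hx⟩) hne]
    | zero => simp
    | add f g _ _ hf hg =>
      simp only [ContinuousMap.add_apply]
      rw [integral_add (hintμ f) (hintμ g), integral_add (hintν f) (hintν g), hf, hg]
    | smul c f _ hf =>
      simp only [ContinuousMap.smul_apply, integral_smul, hf]
  have hall : ∀ f : C(UnitAddTorus d, ℂ), ∫ x : H, f x ∂μ = ∫ x, f x ∂ν := by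
    intro f
    rw [← sub_eq_zero, ← norm_le_zero_iff]
    refine le_of_forall_pos_le_add fun ε hε => ?_
    have hf : f ∈ closure (Submodule.span ℂ (Set.range (UnitAddTorus.mFourier (d := d))) :
        Set C(UnitAddTorus d, ℂ)) := by
      rw [← Submodule.topologicalClosure_coe, UnitAddTorus.span_mFourier_closure_eq_top]
      trivial
    obtain ⟨g, hg, hfg⟩ := Metric.mem_closure_iff.mp hf (ε / 2) (half_pos hε)
    rw [dist_eq_norm] at hfg
    have h1 : ‖∫ x : H, f x ∂μ - ∫ x : H, g x ∂μ‖ ≤ ε / 2 := by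
      rw [← integral_sub (hintμ f) (hintμ g)]
      refine (norm_integral_le_of_norm_le_const (C := ε / 2)
        (Eventually.of_forall fun x => ?_)).trans (by simp)
      exact ((f - g).norm_coe_le_norm x).trans hfg.le
    have h2 : ‖∫ x, f x ∂ν - ∫ x, g x ∂ν‖ ≤ ε / 2 := by
      rw [← integral_sub (hintν f) (hintν g)]
      refine (norm_integral_le_of_norm_le_const (C := ε / 2)
        (Eventually.of_forall fun x => ?_)).trans (by simp)
      exact ((f - g).norm_coe_le_norm x).trans hfg.le
    have h3 := hspan g hg
    calc ‖∫ x : H, f x ∂μ - ∫ x, f x ∂ν‖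
        = ‖(∫ x : H, f x ∂μ - ∫ x : H, g x ∂μ) - (∫ x, f x ∂ν - ∫ x, g x ∂ν)‖ := by
          rw [h3]; congr 1; ring
      _ ≤ _ := norm_sub_le _ _
      _ ≤ 0 + ε := by linarith
  by_contra hne
  obtain ⟨x, hx⟩ : ∃ x, x ∉ H := by
    by_contra! hcon
    exact hne (eq_top_iff.mpr fun x _ => hcon x)
  obtain ⟨f, hf0, hf1, hf01⟩ := exists_continuous_zero_one_of_isClosed hH isClosed_singleton
    (Set.disjoint_singleton_right.mpr hx)
  have hpos : 0 < ∫ x, f x ∂ν :=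
    f.continuous.integral_pos_of_hasCompactSupport_nonneg_nonzero
      (HasCompactSupport.of_compactSpace _) (fun x => (hf01 x).1) (x := x)
      (by rw [hf1 rfl]; exact one_ne_zero)
  have h1 := hall ((⟨Complex.ofReal, Complex.continuous_ofReal⟩ : C(ℝ, ℂ)).comp f)
  simp only [ContinuousMap.comp_apply, ContinuousMap.coe_mk] at h1
  rw [integral_complex_ofReal, integral_complex_ofReal] at h1
  have h2 : ∫ x : H, f x ∂μ = 0 := by
    rw [integral_eq_zero_of_ae]
    exact Eventually.of_forall fun x => hf0 x.2
  rw [h2] at h1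
  exact hpos.ne (by exact_mod_cast h1)

/-- For a generic sequence, the vectors `(Q₀ x, Q₁ Q₀ x, …)` with `x` integral are dense modulo
the integers. -/
theorem exists_prodMat_near {Q : OrthSeq n} (hQ : Q ∈ genericSet n) (k : ℕ)
    (τ : Fin k → Fin n → ℝ) {s : ℝ} (hs : 0 < s) :
    ∃ x : Fin n → ℤ, ∀ (j : Fin k) (i : Fin n), ∃ b : ℤ,
      |(prodMat Q (j + 1)).mulVec (castVec x) i - τ j i - b| < s := by
  let Φ : (Fin n → ℤ) →+ UnitAddTorus (Fin k × Fin n) :=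
    { toFun := fun x q => (((prodMat Q (q.1 + 1)).mulVec (castVec x) q.2 : ℝ) : UnitAddCircle)
      map_zero' := by
        have : castVec (0 : Fin n → ℤ) = 0 := by ext; simp
        ext q
        simp [this]
      map_add' := fun x y => by
        ext q
        simp [castVec_add, Matrix.mulVec_add] }
  have htop : Φ.range.topologicalClosure = ⊤ := by
    refine eq_top_of_mFourier_ne_one _ (AddSubgroup.isClosed_topologicalClosure _) fun m hm => ?_
    have hm' : (fun j i => m (j, i)) ≠ (0 : Fin k → Fin n → ℤ) := fun h => hm <| by
      ext ⟨j, i⟩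
      exact congrFun (congrFun h j) i
    obtain ⟨i, hi⟩ := Set.mem_iInter.mp hQ.2 ⟨k, _, hm'⟩
    refine ⟨Φ (Pi.single i 1), AddSubgroup.le_topologicalClosure _ ⟨_, rfl⟩, fun h1 => ?_⟩
    have hcast : castVec (Pi.single i 1 : Fin n → ℤ) = Pi.single i 1 := by
      ext i'
      by_cases h : i' = i
      · subst h; simp
      · simp [h]
    have h2 : UnitAddTorus.mFourier m (Φ (Pi.single i 1)) =
        Complex.exp (2 * Real.pi * Complex.I * (charVec Q (fun j i => m (j, i)) i : ℝ)) := by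
      have h3 : charVec Q (fun j i => m (j, i)) i =
          ∑ q : Fin k × Fin n, (m q : ℝ) * prodMat Q (q.1 + 1) q.2 i := by
        rw [charVec, Finset.sum_apply, Fintype.sum_prod_type]
        rfl
      rw [h3]
      push_cast
      rw [Finset.mul_sum, Complex.exp_sum]
      refine Finset.prod_congr rfl fun q _ => ?_
      change fourier (m q) (((prodMat Q (q.1 + 1)).mulVec (castVec (Pi.single i 1)) q.2 : ℝ) :
        UnitAddCircle) = _
      rw [fourier_coe_apply, hcast, Matrix.mulVec_single_one]
      congr 1
      simp only [Matrix.col_apply]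
      push_cast
      ring
    rw [h2, Complex.exp_eq_one_iff] at h1
    obtain ⟨b, hb⟩ := h1
    refine hi b ?_
    have h4 : (2 * Real.pi * Complex.I : ℂ) ≠ 0 := Complex.two_pi_I_ne_zero
    have h5 : ((charVec Q (fun j i => m (j, i)) i : ℝ) : ℂ) = ((b : ℝ) : ℂ) := by
      apply mul_left_cancel₀ h4
      rw [hb]; push_cast; ring
    exact_mod_cast h5
  have hdense : (fun q : Fin k × Fin n => ((τ q.1 q.2 : ℝ) : UnitAddCircle)) ∈
      closure (Set.range Φ) := by
    have : closure (Set.range Φ) = ((Φ.range.topologicalClosure :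
        AddSubgroup (UnitAddTorus (Fin k × Fin n))) : Set (UnitAddTorus (Fin k × Fin n))) := by
      rw [AddSubgroup.topologicalClosure_coe, AddMonoidHom.coe_range]
    rw [this, htop]
    trivial
  obtain ⟨_, ⟨x, rfl⟩, hx⟩ := Metric.mem_closure_iff.mp hdense s hs
  refine ⟨x, fun j i => ⟨round ((prodMat Q (j + 1)).mulVec (castVec x) i - τ j i), ?_⟩⟩
  have h1 := (dist_le_pi_dist _ _ (j, i)).trans_lt hx
  rw [dist_comm, dist_eq_norm] at h1
  rw [← UnitAddCircle.norm_eq]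
  exact h1

/-- For a generic sequence, there are integer translations along which the affine iteration with
translation parts `0` looks like the affine iteration with arbitrary translation parts `θ`. -/
theorem exists_shift_near {Q : OrthSeq n} (hQ : Q ∈ genericSet n) (k : ℕ)
    (θ : ℕ → Fin n → ℝ) {s : ℝ} (hs : 0 < s) :
    ∃ t : ℕ → Fin n → ℤ, ∀ j < k, ∀ i,
      |((Q j).1.mulVec (castVec (t j)) + 0 - castVec (t (j + 1))) i - θ j i| < s := by
  let τ : ℕ → Fin n → ℝ := fun j => Nat.rec 0 (fun j v => (Q j).1.mulVec v + θ j) j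
  have hτ0 : τ 0 = 0 := rfl
  have hτ : ∀ j, τ (j + 1) = (Q j).1.mulVec (τ j) + θ j := fun j => rfl
  have hs' : 0 < s / (n + 1) := by positivity
  obtain ⟨x, hx⟩ := exists_prodMat_near hQ k (fun j => τ (j + 1)) hs'
  choose b hb using hx
  let t : ℕ → Fin n → ℤ := fun j => if h : 0 < j ∧ j - 1 < k then b ⟨j - 1, h.2⟩ else x
  have ht0 : t 0 = x := by simp [t]
  have ht : ∀ j (h : j < k), t (j + 1) = b ⟨j, h⟩ := fun j h => by simp [t, h]
  have herr : ∀ j ≤ k, ∀ i,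
      |((prodMat Q j).mulVec (castVec x) - τ j - castVec (t j)) i| < s / (n + 1) := by
    intro j hj i
    rcases j with _ | j
    · simp [prodMat, hτ0, ht0, hs']
    · rw [ht j hj]
      exact hb ⟨j, hj⟩ i
  refine ⟨t, fun j hj i => ?_⟩
  have h1 := herr (j + 1) hj i
  have h2 := abs_orth_mulVec_le (Q j) (fun i => (herr j hj.le i).le) i
  have h3 : ((Q j).1.mulVec (castVec (t j)) + 0 - castVec (t (j + 1))) i - θ j i =
      ((prodMat Q (j + 1)).mulVec (castVec x) - τ (j + 1) - castVec (t (j + 1))) i -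
      (Q j).1.mulVec ((prodMat Q j).mulVec (castVec x) - τ j - castVec (t j)) i := by
    rw [Matrix.mulVec_sub, Matrix.mulVec_sub, Matrix.mulVec_mulVec, hτ, prodMat]
    simp only [Pi.add_apply, Pi.sub_apply, Pi.zero_apply]
    ring
  rw [h3]
  refine (abs_sub _ _).trans_lt ?_
  calc _ < s / (n + 1) + n * (s / (n + 1)) := by linarith
    _ = s := by field_simp; ring

/-! ### Local patterns of the iterated images -/

/-- The integer points with coordinates at most `M` in absolute value. -/
noncomputable def cube (n M : ℕ) : Finset (Fin n → ℤ) := box (fun _ => -M) (2 * M + 1)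

theorem mem_cube {M : ℕ} {x : Fin n → ℤ} : x ∈ cube n M ↔ ∀ i, |x i| ≤ M := by
  rw [cube, mem_box]
  refine forall_congr' fun i => ?_
  rw [abs_le]
  push_cast
  omega

theorem box_zero_subset_cube (L : ℕ) : box (0 : Fin n → ℤ) L ⊆ cube n L := fun x hx => by
  rw [mem_box] at hx
  rw [mem_cube]
  intro i
  have := hx i
  simp only [Pi.zero_apply] at this
  rw [abs_le]
  omega

theorem mem_cube_of_affStep_mem {A : Matrix.orthogonalGroup (Fin n) ℝ} {θ : Fin n → ℝ} {K M : ℕ}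
    (hθ : ∀ i, |θ i| ≤ K) {x : Fin n → ℤ} (h : affStep A.1 θ x ∈ cube n M) :
    x ∈ cube n (n * (M + K + 1)) := by
  rw [mem_cube] at h ⊢
  have h1 : ∀ i, |A.1.mulVec (castVec x) i| ≤ (M + K + 1 : ℝ) := fun i => by
    have e1 := sub_half_le_p (A.1.mulVec (castVec x) i + θ i)
    have e2 := p_lt_add_half (A.1.mulVec (castVec x) i + θ i)
    have e3 := abs_le.mp (hθ i)
    have e4 : |((p (A.1.mulVec (castVec x) i + θ i) : ℤ) : ℝ)| ≤ M := by exact_mod_cast h i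
    have e5 := abs_le.mp e4
    rw [abs_le]
    constructor <;> linarith [e3.1, e3.2, e5.1, e5.2]
  intro i
  have h2 := abs_le_of_orth_mulVec A h1 i
  rw [castVec_apply] at h2
  exact_mod_cast h2

/-- Translating the points at each step only changes the translation parts. -/
theorem add_mem_gam_iff (Q : OrthSeq n) (θ : ℕ → Fin n → ℝ) (t : ℕ → Fin n → ℤ) (k : ℕ)
    (y : Fin n → ℤ) : y + t k ∈ gam Q θ k ↔
      y ∈ gam Q (fun j => (Q j).1.mulVec (castVec (t j)) + θ j - castVec (t (j + 1))) k := by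
  induction k generalizing y with
  | zero => simp [gam]
  | succ k ih =>
    simp only [gam, Set.mem_image]
    constructor
    · rintro ⟨x, hx, hxy⟩
      refine ⟨x - t k, (ih _).mp (by simpa using hx), ?_⟩
      have := affStep_add (Q k).1 (θ k) (x - t k) (t k) (t (k + 1))
      rw [sub_add_cancel, hxy] at this
      exact (add_right_cancel this).symm
    · rintro ⟨x, hx, hxy⟩
      refine ⟨x + t k, (ih _).mpr hx, ?_⟩
      rw [affStep_add (Q k).1 (θ k) x (t k) (t (k + 1)), hxy]

/-- Around any point, the iterated image looks as around `0`, with other bounded translation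
parts. -/
theorem exists_recenter (Q : OrthSeq n) (θ : ℕ → Fin n → ℝ) (k : ℕ) (z : Fin n → ℤ) :
    ∃ θ' : ℕ → Fin n → ℝ, (∀ j i, |θ' j i| ≤ n) ∧
      ∀ y, y + z ∈ gam Q θ k ↔ y ∈ gam Q θ' k := by
  have key : ∃ t : ℕ → Fin n → ℤ, t k = z ∧ ∀ j < k, ∀ i,
      |((Q j).1.mulVec (castVec (t j)) + θ j - castVec (t (j + 1))) i| ≤ n := by
    induction k generalizing z with
    | zero => exact ⟨fun _ => z, rfl, by simp⟩
    | succ k ih =>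
      obtain ⟨w, hw⟩ := exists_near_preimage (Q k) (castVec z - θ k)
      obtain ⟨t, htk, ht⟩ := ih w
      refine ⟨Function.update t (k + 1) z, by simp, fun j hj i => ?_⟩
      rw [Function.update_of_ne (by omega : j ≠ k + 1)]
      rcases Nat.lt_succ_iff_lt_or_eq.mp hj with h | rfl
      · rw [Function.update_of_ne (by omega)]
        exact ht j h i
      · rw [Function.update_self, htk]
        convert hw i using 2
        simp only [Pi.add_apply, Pi.sub_apply]
        ring
  obtain ⟨t, htk, ht⟩ := key
  refine ⟨fun j => if j < k then
    (Q j).1.mulVec (castVec (t j)) + θ j - castVec (t (j + 1)) else 0, fun j i => ?_, fun y => ?_⟩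
  · by_cases h : j < k
    · simpa [h] using ht j h i
    · simp [h]
  · rw [← htk, add_mem_gam_iff]
    rw [gam_congr Q (θ' := fun j => if j < k then
      (Q j).1.mulVec (castVec (t j)) + θ j - castVec (t (j + 1)) else 0) fun j hj => by simp [hj]]

theorem cnt_box_eq_of_iff {Γ Γ' : Set (Fin n → ℤ)} {z : Fin n → ℤ} {L : ℕ}
    (h : ∀ y ∈ box 0 L, y + z ∈ Γ ↔ y ∈ Γ') : cnt Γ (box z L) = cnt Γ' (box 0 L) := by
  apply le_antisymm
  · refine cnt_le_cnt_of_surj (· + z) fun y hy hyΓ => ?_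
    have hmem : y - z ∈ box 0 L := by
      rw [mem_box] at *
      intro i
      have := hy i
      simp only [Pi.sub_apply, Pi.zero_apply]
      omega
    exact ⟨y - z, hmem, (h _ hmem).mp (by simpa using hyΓ), by simp⟩
  · refine cnt_le_cnt_of_surj (· - z) fun y hy hyΓ => ⟨y + z, ?_, (h y hy).mpr hyΓ, by simp⟩
    rw [mem_box] at *
    intro i
    have := hy i
    simp only [Pi.add_apply, Pi.zero_apply] at *
    omega

/-! ### Stability of patterns with respect to the translation parts -/

/-- As ties are rounded down, rounding is not affected by small decrements. -/
theorem exists_p_sub_eq {ι : Type*} (S : Finset ι) (a : ι → ℝ) :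
    ∃ r > 0, ∀ x ∈ S, ∀ σ, 0 ≤ σ → σ ≤ r → p (a x - σ) = p (a x) := by
  obtain ⟨r, hr, h⟩ := exists_pos_forall_le S (fun x => (a x - (p (a x) - 1 / 2)) / 2)
    fun x _ => by linarith [p_lt_add_half (a x)]
  refine ⟨r, hr, fun x hx σ h0 h1 => ?_⟩
  rw [p_eq_iff]
  have h2 := h x hx
  have h3 := sub_half_le_p (a x)
  have h4 := p_lt_add_half (a x)
  constructor <;> linarith

theorem exists_affStep_stable (A : Matrix (Fin n) (Fin n) ℝ) (θ : Fin n → ℝ)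
    (S : Finset (Fin n → ℤ)) :
    ∃ θ₀ : Fin n → ℝ, ∃ r > 0, r ≤ 1 ∧ (∀ i, |θ₀ i - θ i| ≤ 1) ∧
      ∀ θ' : Fin n → ℝ, (∀ i, |θ' i - θ₀ i| < r) → ∀ x ∈ S, affStep A θ' x = affStep A θ x := by
  obtain ⟨r, hr, h⟩ := exists_p_sub_eq (S ×ˢ (Finset.univ : Finset (Fin n)))
    fun q => A.mulVec (castVec q.1) q.2 + θ q.2
  set r' := min (r / 2) 1 with hr'
  have hr0 : 0 < r' := by positivity
  have hr1 : r' ≤ 1 := min_le_right _ _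
  have hr2 : r' ≤ r / 2 := min_le_left _ _
  refine ⟨fun i => θ i - r', r', hr0, hr1, fun i => ?_, fun θ' hθ' x hx => ?_⟩
  · rw [sub_sub_cancel_left, abs_neg, abs_of_pos hr0]; exact hr1
  · funext i
    have h1 := abs_lt.mp (hθ' i)
    have h2 := h (x, i) (by simp [hx]) (θ i - θ' i) (by linarith [h1.2]) (by linarith [h1.1])
    simp only [affStep, proj, Pi.add_apply]
    rw [← h2]
    congr 1
    ring

/-- Every local pattern occurs for an open set of translation parts. -/
theorem exists_gam_stable (Q : OrthSeq n) {θ : ℕ → Fin n → ℝ} {K : ℕ}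
    (hθ : ∀ j i, |θ j i| ≤ K) (k M : ℕ) :
    ∃ θ₀ : ℕ → Fin n → ℝ, ∃ s > 0, ∀ θ' : ℕ → Fin n → ℝ,
      (∀ j < k, ∀ i, |θ' j i - θ₀ j i| < s) →
        ∀ y ∈ cube n M, y ∈ gam Q θ' k ↔ y ∈ gam Q θ k := by
  induction k generalizing M with
  | zero => exact ⟨0, 1, one_pos, fun θ' _ y _ => by simp [gam]⟩
  | succ k ih =>
    obtain ⟨θ₁, s₁, hs₁, h₁⟩ := ih (n * (M + (K + 2) + 1))
    obtain ⟨θ₂, s₂, hs₂, hs₂1, hθ₂, h₂⟩ :=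
      exists_affStep_stable (Q k).1 (θ k) (cube n (n * (M + (K + 2) + 1)))
    refine ⟨Function.update θ₁ k θ₂, min s₁ s₂, lt_min hs₁ hs₂, fun θ' hθ' y hy => ?_⟩
    have e1 := h₁ θ' fun j hj i => by
      have := hθ' j (by omega) i
      rw [Function.update_of_ne (by omega)] at this
      exact this.trans_le (min_le_left _ _)
    have hk : ∀ i, |θ' k i - θ₂ i| < s₂ := fun i => by
      have := hθ' k (by omega) i
      rw [Function.update_self] at this
      exact this.trans_le (min_le_right _ _)
    have e2 := h₂ (θ' k) hk
    have hb' : ∀ i, |θ' k i| ≤ ((K + 2 : ℕ) : ℝ) := fun i => by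
      have a1 := abs_lt.mp (hk i)
      have a2 := abs_le.mp (hθ₂ i)
      have a3 := abs_le.mp (hθ k i)
      rw [abs_le]
      push_cast
      constructor <;> linarith [a1.1, a1.2, a2.1, a2.2, a3.1, a3.2]
    have hb : ∀ i, |θ k i| ≤ ((K + 2 : ℕ) : ℝ) := fun i => by
      have := hθ k i
      push_cast
      linarith
    constructor
    · rintro ⟨x, hx, rfl⟩
      have hxc := mem_cube_of_affStep_mem hb' hy
      exact ⟨x, (e1 x hxc).mp hx, (e2 x hxc).symm⟩
    · rintro ⟨x, hx, rfl⟩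
      have hxc := mem_cube_of_affStep_mem hb hy
      exact ⟨x, (e1 x hxc).mpr hx, e2 x hxc⟩

/-- For a generic sequence, all the translates of the iterated image have the same local
patterns, whatever the translation parts. -/
theorem exists_cnt_eq_cnt_zero {Q : OrthSeq n} (hQ : Q ∈ genericSet n) (θ : ℕ → Fin n → ℝ)
    (k : ℕ) (z : Fin n → ℤ) (L : ℕ) :
    ∃ z', cnt (gam Q θ k) (box z L) = cnt (gam Q 0 k) (box z' L) := by
  obtain ⟨θ', hθ', h1⟩ := exists_recenter Q θ k z
  obtain ⟨θ₀, s, hs, h2⟩ := exists_gam_stable Q hθ' k L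
  obtain ⟨t, ht⟩ := exists_shift_near hQ k θ₀ hs
  refine ⟨t k, ?_⟩
  rw [cnt_box_eq_of_iff fun y _ => h1 y]
  symm
  refine cnt_box_eq_of_iff fun y hy => ?_
  rw [add_mem_gam_iff]
  exact h2 _ (fun j hj i => ht j hj i) y (box_zero_subset_cube L hy)

/-- For a generic sequence, the convergence of the density of the iterated images is uniform with
respect to the translation parts. -/
theorem exists_forall_abs_cnt_sub_le {Q : OrthSeq n} (hQ : Q ∈ genericSet n) (k : ℕ) {η : ℝ}
    (hη : 0 < η) : ∃ L₀ : ℕ, ∀ L ≥ L₀, ∀ θ z,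
      |(cnt (gam Q θ k) (box z L) : ℝ) - rate Q k * L ^ n| ≤ η * L ^ n := by
  obtain ⟨L₀, hL₀⟩ := uDens_rate Q k η hη
  refine ⟨L₀, fun L hL θ z => ?_⟩
  obtain ⟨z', hz'⟩ := exists_cnt_eq_cnt_zero hQ θ k z L
  rw [hz']
  exact hL₀ L hL z'

/-! ### Stability of patterns with respect to the matrices -/

/-- If the numbers `a x` are distinct modulo `1`, then a small perturbation of them has no
effect on the roundings of the `a x + θ`, provided that `θ` is slightly modified: it is enough to
choose the new `θ` so as to be right for the number which is closest to a tie. -/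
theorem exists_p_add_eq {ι : Type*} {S : Finset ι} (hS : S.Nonempty) {a a' : ι → ℝ} {r : ℝ}
    (hgap : ∀ x ∈ S, ∀ y ∈ S, x ≠ y → ∀ b : ℤ, 8 * r ≤ |a x - a y - b|)
    (hr : 0 < r) (ha : ∀ x ∈ S, |a' x - a x| ≤ r) (θ' : ℝ) :
    ∃ θ, |θ - θ'| ≤ r ∧ ∀ x ∈ S, p (a x + θ) = p (a' x + θ') := by
  obtain ⟨x₀, hx₀, hmin⟩ := S.exists_min_image
    (fun x => |a' x + θ' - 1 / 2 - round (a' x + θ' - 1 / 2)|) hS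
  refine ⟨θ' + (a' x₀ - a x₀), by simpa using ha x₀ hx₀, fun y hy => ?_⟩
  by_cases hyx : y = x₀
  · subst hyx
    congr 1
    ring
  have e1 : a y + (θ' + (a' x₀ - a x₀)) = a' y + θ' + ((a' x₀ - a x₀) - (a' y - a y)) := by ring
  rw [e1]
  have h1 := abs_le.mp (ha x₀ hx₀)
  have h2 := abs_le.mp (ha y hy)
  refine p_add_of_far (s := 3 * r) (fun b => ?_) ?_
  · by_contra! hb
    have h3 := (hmin y hy).trans (round_le (a' y + θ' - 1 / 2) b)
    have h4 := hgap y hy x₀ hx₀ hyx (b - round (a' x₀ + θ' - 1 / 2))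
    have h5 := abs_lt.mp hb
    have h6 := abs_lt.mp (h3.trans_lt hb)
    have h7 : |a y - a x₀ - ((b - round (a' x₀ + θ' - 1 / 2) : ℤ) : ℝ)| < 8 * r := by
      push_cast
      rw [abs_lt]
      constructor <;> linarith [h1.1, h1.2, h2.1, h2.2, h5.1, h5.2, h6.1, h6.2]
    linarith
  · rw [abs_lt]
    constructor <;> linarith [h1.1, h1.2, h2.1, h2.2]

theorem exists_affStep_eq_of_near {A : Matrix.orthogonalGroup (Fin n) ℝ}
    (hA : ∀ u : Fin n → ℤ, u ≠ 0 → ∀ i, ∀ b : ℤ, A.1.mulVec (castVec u) i ≠ b) (M : ℕ) :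
    ∃ r > 0, ∀ A' : Matrix.orthogonalGroup (Fin n) ℝ, (∀ i j, |A'.1 i j - A.1 i j| < r) →
      ∀ θ' : Fin n → ℝ, ∃ θ : Fin n → ℝ, (∀ i, |θ i - θ' i| ≤ 1) ∧
        ∀ x ∈ cube n M, affStep A'.1 θ' x = affStep A.1 θ x := by
  classical
  obtain ⟨g, hg, hgle⟩ := exists_pos_forall_le
    (((cube n M ×ˢ cube n M).filter fun q => q.1 ≠ q.2) ×ˢ (Finset.univ : Finset (Fin n)))
    (fun q => |A.1.mulVec (castVec (q.1.1 - q.1.2)) q.2 -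
      round (A.1.mulVec (castVec (q.1.1 - q.1.2)) q.2)|)
    (fun q hq => by
      rw [abs_pos, sub_ne_zero]
      simp only [Finset.mem_product, Finset.mem_filter] at hq
      exact hA _ (sub_ne_zero.mpr hq.1.2) _ _)
  set r := min (g / 8) 1 with hr
  have hr0 : 0 < r := by positivity
  have hrg : 8 * r ≤ g := by linarith [min_le_left (g / 8) 1]
  refine ⟨r / (n * M + 1), by positivity, fun A' hA' θ' => ?_⟩
  have hmul : ∀ x ∈ cube n M, ∀ i,
      |A'.1.mulVec (castVec x) i - A.1.mulVec (castVec x) i| ≤ r := fun x hx i => by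
    have h1 := abs_mulVec_le (A := A'.1 - A.1) (a := r / (n * M + 1)) (v := castVec x) (M := M)
      (fun i j => by rw [Matrix.sub_apply]; exact (hA' i j).le)
      (fun i => by rw [castVec_apply]; exact_mod_cast mem_cube.mp hx i) i
    rw [Matrix.sub_mulVec, Pi.sub_apply] at h1
    refine h1.trans ?_
    rw [show (n : ℝ) * (r / (n * M + 1) * M) = (r * (n * M)) / (n * M + 1) by ring,
      div_le_iff₀ (by positivity)]
    nlinarith
  have hne : (cube n M).Nonempty := ⟨0, mem_cube.mpr fun i => by simp⟩
  have hex := fun i => exists_p_add_eq hne (a := fun x => A.1.mulVec (castVec x) i)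
    (a' := fun x => A'.1.mulVec (castVec x) i) (fun x hx y hy hxy b => by
      refine hrg.trans ((hgle ((x, y), i) (by simp [hx, hy, hxy])).trans ?_)
      refine (round_le _ b).trans (le_of_eq ?_)
      rw [castVec_sub, Matrix.mulVec_sub, Pi.sub_apply]) hr0 (fun x hx => hmul x hx i) (θ' i)
  choose θ hθ h using hex
  refine ⟨θ, fun i => (hθ i).trans (min_le_right _ _), fun x hx => ?_⟩
  funext i
  exact (h i x hx).symm

/-- If the matrices `Q j` map no nonzero integer vector to a vector with an integral coordinate,
then the local patterns of the iterated images for a nearby sequence of matrices are also local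
patterns for `Q`. -/
theorem exists_gam_eq_of_near {Q : OrthSeq n}
    (hQ : ∀ j, ∀ u : Fin n → ℤ, u ≠ 0 → ∀ i, ∀ b : ℤ, (Q j).1.mulVec (castVec u) i ≠ b)
    (K k M : ℕ) :
    ∃ r > 0, ∀ Q' : OrthSeq n, dist Q' Q < r → ∀ θ' : ℕ → Fin n → ℝ, (∀ j i, |θ' j i| ≤ K) →
      ∃ θ : ℕ → Fin n → ℝ, ∀ y ∈ cube n M, y ∈ gam Q' θ' k ↔ y ∈ gam Q θ k := by
  induction k generalizing M with
  | zero => exact ⟨1, one_pos, fun Q' _ θ' _ => ⟨0, fun y _ => by simp [gam]⟩⟩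
  | succ k ih =>
    obtain ⟨r₁, hr₁, h₁⟩ := ih (n * (M + (K + 1) + 1))
    obtain ⟨r₂, hr₂, h₂⟩ := exists_affStep_eq_of_near (hQ k) (n * (M + (K + 1) + 1))
    refine ⟨min r₁ r₂, lt_min hr₁ hr₂, fun Q' hQ' θ' hθ' => ?_⟩
    obtain ⟨θ₁, e1⟩ := h₁ Q' (hQ'.trans_le (min_le_left _ _)) θ' hθ'
    obtain ⟨θ₂, hθ₂, e2⟩ := h₂ (Q' k)
      (fun i j => (abs_sub_le_dist Q' Q k i j).trans_lt (hQ'.trans_le (min_le_right _ _))) (θ' k)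
    refine ⟨Function.update θ₁ k θ₂, fun y hy => ?_⟩
    have hb' : ∀ i, |θ' k i| ≤ ((K + 1 : ℕ) : ℝ) := fun i => by
      have := hθ' k i
      push_cast
      linarith
    have hb : ∀ i, |θ₂ i| ≤ ((K + 1 : ℕ) : ℝ) := fun i => by
      have a2 := abs_le.mp (hθ₂ i)
      have a3 := abs_le.mp (hθ' k i)
      rw [abs_le]
      push_cast
      constructor <;> linarith [a2.1, a2.2, a3.1, a3.2]
    rw [gam, gam, Function.update_self, gam_congr Q (θ' := θ₁) fun j hj =>
      Function.update_of_ne (by omega) _ _]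
    constructor
    · rintro ⟨x, hx, rfl⟩
      have hxc := mem_cube_of_affStep_mem hb' hy
      exact ⟨x, (e1 x hxc).mp hx, (e2 x hxc).symm⟩
    · rintro ⟨x, hx, rfl⟩
      have hxc := mem_cube_of_affStep_mem hb hy
      exact ⟨x, (e1 x hxc).mpr hx, e2 x hxc⟩

theorem mulVec_ne_int_of_mem_genericSet {Q : OrthSeq n} (hQ : Q ∈ genericSet n) (j : ℕ)
    (u : Fin n → ℤ) (hu : u ≠ 0) (i : Fin n) (b : ℤ) : (Q j).1.mulVec (castVec u) i ≠ b := by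
  obtain ⟨c, hc, h⟩ := Set.mem_iInter.mp hQ.1 (∑ i, (u i).natAbs)
  have h1 := h j u hu (fun i => by
    have := Finset.single_le_sum (f := fun i => (u i).natAbs) (fun _ _ => Nat.zero_le _)
      (Finset.mem_univ i)
    rw [Int.abs_eq_natAbs]
    exact_mod_cast this) i b
  intro h2
  rw [h2, sub_self, abs_zero] at h1
  linarith

/-- The rate of injectivity in time `k` is upper semicontinuous at generic sequences. -/
theorem exists_rate_lt_of_near {Q : OrthSeq n} (hQ : Q ∈ genericSet n) {k : ℕ} {ε : ℝ}
    (hε : rate Q k < ε) : ∃ r > 0, ∀ Q', dist Q' Q < r → rate Q' k < ε := by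
  obtain ⟨η, hη0, hη⟩ : ∃ η > 0, rate Q k + 2 * η < ε :=
    ⟨(ε - rate Q k) / 4, by linarith, by linarith⟩
  obtain ⟨L₀, hL₀⟩ := exists_forall_abs_cnt_sub_le hQ k hη0
  set L := max L₀ 1 with hL
  have hLpos : 0 < L := by simp [hL]
  obtain ⟨r, hr, h⟩ := exists_gam_eq_of_near (mulVec_ne_int_of_mem_genericSet hQ) n k L
  refine ⟨r, hr, fun Q' hQ' => ?_⟩
  have h1 : ∀ z, (cnt (gam Q' 0 k) (box z L) : ℝ) ≤ (rate Q k + η) * L ^ n := fun z => by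
    obtain ⟨θ', hθ', e1⟩ := exists_recenter Q' 0 k z
    obtain ⟨θ, e2⟩ := h Q' hQ' θ' hθ'
    rw [cnt_box_eq_of_iff (Γ' := gam Q θ k) fun y hy =>
      (e1 y).trans (e2 y (box_zero_subset_cube L hy))]
    have := (abs_le.mp (hL₀ L (le_max_left _ _) θ 0)).2
    linarith
  have h2 : rate Q' k ≤ rate Q k + η := by
    refine le_of_forall_pos_le_add fun δ hδ => ?_
    have hnn : 0 ≤ rate Q k + η := by linarith [rate_nonneg Q k]
    set δ' := δ / (rate Q k + η + 1) with hδ'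
    have hδ'0 : 0 < δ' := by positivity
    obtain ⟨L₁, hL₁⟩ := uDens_rate Q' k δ' hδ'0
    obtain ⟨L', h3, h4⟩ := ((eventually_add_pow_le n L hδ'0).and
      (eventually_ge_atTop (max L₁ 1))).exists
    have hp : (0 : ℝ) < (L' : ℝ) ^ n := by
      have : 0 < L' := lt_of_lt_of_le (by simp) ((le_max_right _ _).trans h4)
      positivity
    have h5 := cnt_box_le_of_box hLpos h1 0 L'
    have h6 := (abs_le.mp (hL₁ L' ((le_max_left _ _).trans h4) 0)).1
    have h7 := mul_le_mul_of_nonneg_left h3 hnn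
    have h8 : rate Q' k * (L' : ℝ) ^ n ≤ (rate Q k + η + δ) * (L' : ℝ) ^ n := by
      have h9 : (rate Q k + η + 1) * δ' = δ := by rw [hδ']; field_simp
      have h10 : ((rate Q k + η + 1) * δ') * (L' : ℝ) ^ n = δ * (L' : ℝ) ^ n := by rw [h9]
      linarith
    exact le_of_mul_le_mul_right h8 hp
  linarith

/-! ### Merging pairs of points -/

theorem exists_int_abs_lt {c t : ℝ} (hc : 0 < c) (h : ∀ b : ℤ, c ≤ |t - b|) :
    ∃ b : ℤ, |(b : ℝ)| < |t| ∧ |t - b| ≤ 1 - c := by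
  have key : ∀ t : ℝ, 0 ≤ t → (∀ b : ℤ, c ≤ |t - b|) →
      ∃ b : ℤ, |(b : ℝ)| < |t| ∧ |t - b| ≤ 1 - c := by
    intro t ht h
    have h1 := h ⌊t⌋
    have h2 := h (⌊t⌋ + 1)
    have h3 := Int.floor_le t
    have h4 := Int.lt_floor_add_one t
    have h5 : (0 : ℝ) ≤ ⌊t⌋ := by exact_mod_cast Int.floor_nonneg.mpr ht
    rw [abs_of_nonneg (by linarith)] at h1
    push_cast at h2
    rw [abs_of_nonpos (by linarith)] at h2
    refine ⟨⌊t⌋, ?_, ?_⟩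
    · rw [abs_of_nonneg h5, abs_of_nonneg ht]; linarith
    · rw [abs_of_nonneg (by linarith)]; linarith
  rcases le_total 0 t with ht | ht
  · exact key t ht h
  · obtain ⟨b, h1, h2⟩ := key (-t) (by linarith) fun b => by
      have := h (-b)
      rw [← abs_neg]
      convert this using 2
      push_cast; ring
    refine ⟨-b, ?_, ?_⟩
    · push_cast; rwa [abs_neg, ← abs_neg t]
    · rw [← abs_neg]
      convert h2 using 2
      push_cast; ring

/-- Modulo `1`, every half-open interval of length `1 / N` contains a point of `a + ℤ / N`. -/
theorem exists_grid_mem {N : ℕ} (hN : 0 < N) (a lo : ℝ) :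
    ∃ j : Fin N, ∃ b : ℤ, lo < a + (j : ℕ) / N - b ∧ a + (j : ℕ) / N - b ≤ lo + 1 / N := by
  have hN' : (0 : ℝ) < N := by exact_mod_cast hN
  have hNz : (0 : ℤ) < N := by exact_mod_cast hN
  set w : ℤ := ⌊(N : ℝ) * (lo - a)⌋ + 1 with hw
  have h1 : (N : ℝ) * (lo - a) < w := by rw [hw]; push_cast; exact Int.lt_floor_add_one _
  have h2 : (w : ℝ) ≤ N * (lo - a) + 1 := by
    rw [hw]; push_cast; linarith [Int.floor_le ((N : ℝ) * (lo - a))]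
  have h3 := Int.emod_nonneg w hNz.ne'
  have h4 := Int.emod_lt_of_pos w hNz
  have h5 : ((w % N).toNat : ℤ) = w % N := Int.toNat_of_nonneg h3
  refine ⟨⟨(w % N).toNat, by omega⟩, -(w / N), ?_⟩
  have h6 : (((w % N).toNat : ℕ) : ℝ) = w - N * (w / N : ℤ) := by
    have e := Int.mul_ediv_add_emod w N
    have : (((w % N).toNat : ℕ) : ℝ) = ((w % N : ℤ) : ℝ) := by exact_mod_cast h5
    rw [this, eq_sub_iff_add_eq']
    exact_mod_cast e
  have h7 : a + (((w % N).toNat : ℕ) : ℝ) / N - ((-(w / N) : ℤ) : ℝ) = a + w / N := by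
    rw [h6]; push_cast; field_simp; ring
  simp only
  rw [h7]
  constructor
  · have : lo - a < w / N := by rw [lt_div_iff₀ hN']; linarith
    linarith
  · have : (w : ℝ) / N ≤ lo - a + 1 / N := by
      rw [div_le_iff₀ hN', add_mul, one_div, inv_mul_cancel₀ hN'.ne']; linarith
    linarith

/-- If `t` is at distance less than `1` from the integer `b`, then the roundings of two numbers
with difference `t` differ by `b`, after a suitable translation chosen in a finite grid. -/
theorem exists_grid_p_add {N : ℕ} (hN : 0 < N) {c t : ℝ} (hNc : 1 ≤ N * c) {b : ℤ}
    (hb : |t - b| ≤ 1 - c) (a : ℝ) :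
    ∃ j : Fin N, p (a + (j : ℕ) / N + t) = p (a + (j : ℕ) / N) + b := by
  have hN' : (0 : ℝ) < N := by exact_mod_cast hN
  have hc : 1 / (N : ℝ) ≤ c := by rw [div_le_iff₀ hN']; linarith
  have hc0 : 0 < 1 / (N : ℝ) := by positivity
  have key : ∀ y : ℝ, p (y + (t - b)) = p y → p (y + t) = p y + b := fun y hy => by
    rw [← hy, ← p_add_int]; congr 1; ring
  have hb' := abs_le.mp hb
  rcases le_total 0 (t - b) with h | h
  · obtain ⟨j, m, h1, h2⟩ := exists_grid_mem hN a (-1 / 2)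
    refine ⟨j, key _ ?_⟩
    rw [(p_eq_iff (a + (j : ℕ) / N) m).mpr ⟨by linarith, by linarith⟩, p_eq_iff]
    constructor <;> linarith
  · obtain ⟨j, m, h1, h2⟩ := exists_grid_mem hN a (1 / 2 - 1 / N)
    refine ⟨j, key _ ?_⟩
    rw [(p_eq_iff (a + (j : ℕ) / N) m).mpr ⟨by linarith, by linarith⟩, p_eq_iff]
    constructor <;> linarith

/-- The composition of the `m` affine steps of indices `k, k + 1, …, k + m - 1`. -/
noncomputable def iterFrom (Q : OrthSeq n) (θ : ℕ → Fin n → ℝ) :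
    ℕ → ℕ → (Fin n → ℤ) → (Fin n → ℤ)
  | 0, _ => id
  | m + 1, k => iterFrom Q θ m (k + 1) ∘ affStep (Q k).1 (θ k)

theorem iterFrom_image_gam (Q : OrthSeq n) (θ : ℕ → Fin n → ℝ) (m k : ℕ) :
    iterFrom Q θ m k '' gam Q θ k = gam Q θ (k + m) := by
  induction m generalizing k with
  | zero => simp [iterFrom]
  | succ m ih =>
    rw [iterFrom, Set.image_comp, ← gam, ih, show k + 1 + m = k + (m + 1) by ring]

theorem iterFrom_congr (Q : OrthSeq n) {θ θ' : ℕ → Fin n → ℝ} {m k : ℕ}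
    (h : ∀ j ≥ k, θ j = θ' j) : iterFrom Q θ m k = iterFrom Q θ' m k := by
  induction m generalizing k with
  | zero => rfl
  | succ m ih => rw [iterFrom, iterFrom, ih fun j hj => h j (by omega), h k le_rfl]

theorem enrm_le_enrm_iterFrom (Q : OrthSeq n) {θ : ℕ → Fin n → ℝ} {K : ℝ} (hK : 0 ≤ K)
    (hθ : ∀ j i, |θ j i| ≤ K) (m k : ℕ) (x : Fin n → ℤ) :
    enrm (castVec x) ≤ enrm (castVec (iterFrom Q θ m k x)) + m * (n * (K + 1)) := by
  induction m generalizing k x with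
  | zero => simp [iterFrom]
  | succ m ih =>
    have h1 := enrm_le_enrm_affStep (Q k) hK (hθ k) x
    have h2 := ih (k + 1) (affStep (Q k).1 (θ k) x)
    simp only [iterFrom, Function.comp_apply]
    push_cast
    linarith

theorem exists_card_le_card_fiber {ι κ : Type*} [Fintype κ] [DecidableEq κ] [Nonempty κ]
    (S : Finset ι) (f : ι → κ) :
    ∃ y, S.card ≤ Fintype.card κ * (S.filter fun x => f x = y).card := by
  by_contra! h
  have h1 : S.card = ∑ y, (S.filter fun x => f x = y).card :=
    Finset.card_eq_sum_card_fiberwise fun x _ => Finset.mem_univ _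
  have h2 : ∑ y : κ, Fintype.card κ * (S.filter fun x => f x = y).card < ∑ _y : κ, S.card :=
    Finset.sum_lt_sum_of_nonempty Finset.univ_nonempty fun y _ => h y
  rw [← Finset.mul_sum, ← h1] at h2
  simp at h2

/-- Given many pairs of points with the same difference `u`, it is possible to choose translation
parts so that a positive proportion of the pairs are merged in a given number of steps. At each
step, the image of the difference under the matrix is not an integer vector, and the translation
part is chosen so that for many pairs, the new difference is obtained by truncating this image
towards `0`; this reduces the Euclidean norm of the difference. -/
theorem exists_merge {Q : OrthSeq n} {ℓ : ℕ} {c : ℝ} (hc : 0 < c)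
    (hQ : ∀ j, ∀ u : Fin n → ℤ, u ≠ 0 → (∀ i, |u i| ≤ ℓ) → ∀ i, ∀ b : ℤ,
      c ≤ |(Q j).1.mulVec (castVec u) i - b|) {N : ℕ} (hN : 0 < N) (hNc : 1 ≤ N * c)
    (m : ℕ) (hm : m ≤ ℓ) (k : ℕ) {u : Fin n → ℤ} (hu : ∑ i, u i ^ 2 ≤ m)
    (S : Finset (Fin n → ℤ)) (f g : (Fin n → ℤ) → (Fin n → ℤ)) (hfg : ∀ x ∈ S, g x = f x + u) :
    ∃ θ : ℕ → Fin n → ℝ, (∀ j < k, θ j = 0) ∧ (∀ j i, |θ j i| ≤ 1) ∧ ∃ S' ⊆ S,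
      S.card ≤ (N ^ n) ^ m * S'.card ∧
      ∀ x ∈ S', iterFrom Q θ m k (g x) = iterFrom Q θ m k (f x) := by
  classical
  have hN' : (0 : ℝ) < N := by exact_mod_cast hN
  induction m generalizing k u S f g with
  | zero =>
    refine ⟨0, by simp, by simp, S, subset_rfl, by simp, fun x hx => ?_⟩
    have hu0 : u = 0 := by
      funext i
      have h1 : u i ^ 2 ≤ ∑ i, u i ^ 2 :=
        Finset.single_le_sum (f := fun i => u i ^ 2) (fun i _ => sq_nonneg _) (Finset.mem_univ i)
      have h2 : u i ^ 2 = 0 := le_antisymm (by push_cast at hu; omega) (sq_nonneg _)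
      simpa using h2
    rw [hfg x hx, hu0, add_zero]
  | succ m ih =>
    by_cases hu0 : u = 0
    · refine ⟨0, by simp, by simp, S, subset_rfl, ?_, fun x hx => ?_⟩
      · exact Nat.le_mul_of_pos_left _ (by positivity)
      · rw [hfg x hx, hu0, add_zero]
    have hbound : ∀ i, |u i| ≤ ℓ := fun i => by
      have h1 : u i ^ 2 ≤ ∑ i, u i ^ 2 :=
        Finset.single_le_sum (f := fun i => u i ^ 2) (fun i _ => sq_nonneg _) (Finset.mem_univ i)
      have h2 : |u i| ≤ u i ^ 2 := by
        rw [← sq_abs]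
        exact Int.le_self_sq _
      omega
    have hgap := hQ k u hu0 hbound
    choose u' hu'lt hu' using fun i => exists_int_abs_lt hc (hgap i)
    have hdec : ∑ i, u' i ^ 2 < ∑ i, u i ^ 2 := by
      have h1 : ∑ i, ((u' i : ℝ)) ^ 2 < ∑ i, (u i : ℝ) ^ 2 := by
        have h2 := dotProduct_orth_mulVec (Q k) (castVec u)
        have h3 : castVec u ⬝ᵥ castVec u = ∑ i, (u i : ℝ) ^ 2 := by
          simp [dotProduct, sq]
        rw [← h3, ← h2, dotProduct]
        obtain ⟨i₀, -⟩ := Function.ne_iff.mp hu0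
        refine Finset.sum_lt_sum_of_nonempty ⟨i₀, Finset.mem_univ _⟩ fun i _ => ?_
        rw [← sq, sq_lt_sq]
        exact hu'lt i
      exact_mod_cast h1
    -- for each pair, some translation part in a finite grid does the job
    have hgrid := fun x i => exists_grid_p_add hN hNc (hu' i)
      ((Q k).1.mulVec (castVec (f x)) i)
    choose J hJ using hgrid
    have hNne : Nonempty (Fin N) := ⟨⟨0, hN⟩⟩
    obtain ⟨y, hy⟩ := exists_card_le_card_fiber S J
    rw [Fintype.card_fun, Fintype.card_fin, Fintype.card_fin] at hy
    set θk : Fin n → ℝ := fun i => ((y i : ℕ) : ℝ) / N with hθk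
    obtain ⟨θ, hθ0, hθ1, S', hS', hcard, hmerge⟩ := ih (by omega) (k + 1) (u := u')
      (by push_cast at hu; omega) (S.filter fun x => J x = y)
      (affStep (Q k).1 θk ∘ f) (affStep (Q k).1 θk ∘ g) (fun x hx => by
        obtain ⟨hxS, hxJ⟩ := Finset.mem_filter.mp hx
        funext i
        simp only [Function.comp_apply, affStep, proj, Pi.add_apply, hfg x hxS, castVec_add,
          Matrix.mulVec_add, hθk]
        rw [← hxJ, ← hJ x i]
        congr 1
        ring)
    refine ⟨Function.update θ k θk, fun j hj => ?_, fun j i => ?_, S',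
      hS'.trans (Finset.filter_subset _ _), ?_, fun x hx => ?_⟩
    · rw [Function.update_of_ne (by omega)]
      exact hθ0 j (by omega)
    · by_cases hj : j = k
      · subst hj
        rw [Function.update_self, hθk, abs_of_nonneg (by positivity)]
        refine div_le_one_of_le₀ ?_ hN'.le
        exact_mod_cast (y i).2.le
      · rw [Function.update_of_ne hj]
        exact hθ1 j i
    · calc S.card ≤ N ^ n * (S.filter fun x => J x = y).card := hy
        _ ≤ N ^ n * ((N ^ n) ^ m * S'.card) := Nat.mul_le_mul_left _ hcard
        _ = (N ^ n) ^ (m + 1) * S'.card := by ring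
    · have h1 := hmerge x hx
      simp only [iterFrom, Function.comp_apply, Function.update_self]
      rw [iterFrom_congr Q (θ := Function.update θ k θk) (θ' := θ) fun j hj =>
        Function.update_of_ne (by omega) _ _]
      exact h1

/-- If `S` is a finite set of points `x` of a set `G` such that `x` and `x + u` have the same
image under `φ`, then the elements of `S` are redundant for the computation of `φ '' G`. -/
theorem exists_notMem_of_merge {G S : Finset (Fin n → ℤ)} {u : Fin n → ℤ} (hu : u ≠ 0)
    {φ : (Fin n → ℤ) → (Fin n → ℤ)} (hSG : ∀ x ∈ S, x + u ∈ G)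
    (hφ : ∀ x ∈ S, φ (x + u) = φ x) {x : Fin n → ℤ} (hx : x ∈ G) :
    ∃ x' ∈ G, x' ∉ S ∧ φ x' = φ x := by
  classical
  -- the last element in the direction of `u` of the fibre of `x`
  obtain ⟨x', hx', hmax⟩ := (G.filter fun y => φ y = φ x).exists_max_image (fun y => y ⬝ᵥ u)
    ⟨x, by simp [hx]⟩
  rw [Finset.mem_filter] at hx'
  refine ⟨x', hx'.1, fun hS => ?_, hx'.2⟩
  have h1 := hmax (x' + u) (Finset.mem_filter.mpr ⟨hSG x' hS, (hφ x' hS).trans hx'.2⟩)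
  rw [add_dotProduct] at h1
  have h2 : 0 < u ⬝ᵥ u := by
    obtain ⟨i, hi⟩ := Function.ne_iff.mp hu
    refine Finset.sum_pos' (fun i _ => mul_self_nonneg _) ⟨i, Finset.mem_univ _, ?_⟩
    exact mul_self_pos.mpr hi
  linarith

/-- In a set of density at least `ε`, a positive proportion of the points `x` have a neighbour
`x + u` in the set, with the same vector `u`. -/
theorem exists_many_pairs {Γ : Set (Fin n → ℤ)} {ε R : ℝ} {ℓ : ℕ} (hn : 0 < n) (hε : 0 < ε)
    (hℓ : 8 / ε ≤ ℓ) (hΓ : ε / 2 * (eball n R).card ≤ cnt Γ (eball n R))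
    (hgrowth : ((eball n (R + n * ℓ)).card : ℝ) ≤ 2 * (eball n R).card) :
    ∃ u : Fin n → ℤ, u ≠ 0 ∧ (∀ i, |u i| ≤ ℓ) ∧ ∃ S ⊆ eball n R,
      (∀ x ∈ S, x ∈ Γ ∧ x + u ∈ Γ) ∧
        ε / 4 * (eball n R).card ≤ (cube n ℓ).card * (S.card : ℝ) := by
  classical
  have hℓ0 : (0 : ℝ) < ℓ := lt_of_lt_of_le (by positivity) hℓ
  have hℓ1 : (1 : ℝ) ≤ ℓ := by
    have : 0 < ℓ := by exact_mod_cast hℓ0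
    exact_mod_cast this
  set I : Set (Fin n → ℤ) := {x | x ∈ Γ ∧ ∀ u ∈ cube n ℓ, u ≠ 0 → x + u ∉ Γ} with hI
  have hIbox : ∀ z, (cnt I (box z ℓ) : ℝ) ≤ 1 / (ℓ : ℝ) ^ n * (ℓ : ℝ) ^ n := fun z => by
    rw [one_div, inv_mul_cancel₀ (by positivity)]
    have : cnt I (box z ℓ) ≤ 1 := by
      refine Finset.card_le_one.mpr fun x hx y hy => ?_
      simp only [Finset.mem_filter, mem_box] at hx hy
      by_contra hne
      refine hx.2.2 (y - x) (mem_cube.mpr fun i => ?_) (sub_ne_zero.mpr (Ne.symm hne))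
        (by simpa using hy.2.1)
      have h1 := hx.1 i
      have h2 := hy.1 i
      simp only [Pi.sub_apply]
      rw [abs_le]
      omega
    exact_mod_cast this
  have hIcnt : (cnt I (eball n R) : ℝ) ≤ ε / 4 * (eball n R).card := by
    refine (cnt_eball_le (by exact_mod_cast hℓ0) hIbox R).trans ?_
    have h1 : 1 / (ℓ : ℝ) ^ n ≤ ε / 8 := by
      have h2 : (ℓ : ℝ) ≤ (ℓ : ℝ) ^ n := le_self_pow₀ hℓ1 hn.ne'
      rw [div_le_iff₀ (by positivity)]
      rw [div_le_iff₀ hε] at hℓ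
      nlinarith
    calc 1 / (ℓ : ℝ) ^ n * (eball n (R + n * ℓ)).card ≤ ε / 8 * (2 * (eball n R).card) :=
          mul_le_mul h1 hgrowth (by positivity) (by positivity)
      _ = ε / 4 * (eball n R).card := by ring
  set T := (eball n R).filter (· ∈ Γ \ I) with hT
  have hTcard : ε / 4 * (eball n R).card ≤ T.card := by
    have h1 : cnt Γ (eball n R) ≤ cnt I (eball n R) + cnt (Γ \ I) (eball n R) := by
      refine le_trans ?_ (cnt_union_le _ _ _)
      refine cnt_le_cnt_of_surj id fun y hy hyΓ => ⟨y, hy, ?_, rfl⟩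
      by_cases h : y ∈ I
      · exact Or.inl h
      · exact Or.inr ⟨hyΓ, h⟩
    have h2 : cnt (Γ \ I) (eball n R) = T.card := by
      rw [cnt, hT]
      congr
    rw [h2] at h1
    have h3 : (cnt Γ (eball n R) : ℝ) ≤ cnt I (eball n R) + T.card := by exact_mod_cast h1
    linarith
  have hex : ∀ x, ∃ u : cube n ℓ, x ∈ T → u.1 ≠ 0 ∧ x + u.1 ∈ Γ := fun x => by
    by_cases hx : x ∈ T
    · obtain ⟨hxΓ, hxI⟩ := (Finset.mem_filter.mp hx).2
      simp only [hI, Set.mem_ofPred_eq, not_and, not_forall, not_not] at hxI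
      obtain ⟨u, hu, hu0, hxu⟩ := hxI hxΓ
      exact ⟨⟨u, hu⟩, fun _ => ⟨hu0, hxu⟩⟩
    · exact ⟨⟨0, mem_cube.mpr fun i => by simp⟩, fun h => absurd h hx⟩
  choose U hU using hex
  have : Nonempty (cube n ℓ) := ⟨⟨0, mem_cube.mpr fun i => by simp⟩⟩
  obtain ⟨u, hu⟩ := exists_card_le_card_fiber T U
  rw [Fintype.card_coe] at hu
  have hcard : ε / 4 * (eball n R).card ≤
      (cube n ℓ).card * ((T.filter fun x => U x = u).card : ℝ) :=
    hTcard.trans (by exact_mod_cast hu)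
  have hE : (0 : ℝ) ≤ (eball n R).card := by positivity
  by_cases hne : (T.filter fun x => U x = u).Nonempty
  · obtain ⟨x, hx⟩ := hne
    have hx' := Finset.mem_filter.mp hx
    refine ⟨u.1, hx'.2 ▸ (hU x hx'.1).1, mem_cube.mp u.2, T.filter fun x => U x = u,
      (Finset.filter_subset _ _).trans (Finset.filter_subset _ _), fun y hy => ?_, hcard⟩
    have hy' := Finset.mem_filter.mp hy
    exact ⟨(Finset.mem_filter.mp hy'.1).2.1, hy'.2 ▸ (hU y hy'.1).2⟩
  · -- the ball is empty, so that any nonzero vector `u` is suitable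
    rw [Finset.not_nonempty_iff_eq_empty] at hne
    rw [hne] at hcard
    refine ⟨fun _ => 1, fun h => ?_, fun i => ?_, ∅, Finset.empty_subset _, by simp, hcard⟩
    · have := congrFun h ⟨0, hn⟩
      simp at this
    · simp only [abs_one]
      exact_mod_cast hℓ1

/-- For a generic sequence, as long as the density of the iterated images is at least `ε`, it
decreases by a definite amount in a definite number of steps. -/
theorem exists_rate_add_le (hn : 0 < n) {Q : OrthSeq n} (hQ : Q ∈ genericSet n) {ε : ℝ}
    (hε : 0 < ε) : ∃ m : ℕ, ∃ c > 0, ∀ k, ε ≤ rate Q k → rate Q (k + m) + c ≤ rate Q k := by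
  classical
  obtain ⟨ℓ, hℓ⟩ := exists_nat_ge (8 / ε)
  set m := n * ℓ ^ 2 with hm
  obtain ⟨c₀, hc₀, hgap⟩ := Set.mem_iInter.mp hQ.1 m
  obtain ⟨N, hN⟩ := exists_nat_ge (1 / c₀)
  have hN0 : 0 < N := by
    have : (0 : ℝ) < N := lt_of_lt_of_le (by positivity) hN
    exact_mod_cast this
  have hNc : 1 ≤ N * c₀ := by rwa [div_le_iff₀ hc₀] at hN
  have hcube : (0 : ℝ) < (cube n ℓ).card := by
    have : 0 < (cube n ℓ).card := Finset.card_pos.mpr ⟨0, mem_cube.mpr fun i => by simp⟩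
    exact_mod_cast this
  set c₁ : ℝ := ε / 4 / ((cube n ℓ).card * (N ^ n) ^ m) with hc₁
  have hc₁0 : 0 < c₁ := by positivity
  refine ⟨m, c₁ / 2, by positivity, fun k hk => ?_⟩
  obtain ⟨η, hη0, hη1, hηε, hηc⟩ : ∃ η > 0, η ≤ 1 ∧ η ≤ ε / 8 ∧ η ≤ c₁ / 12 :=
    ⟨min 1 (min (ε / 8) (c₁ / 12)), by positivity, min_le_left _ _,
      (min_le_right _ _).trans (min_le_left _ _), (min_le_right _ _).trans (min_le_right _ _)⟩
  obtain ⟨L₁, hL₁⟩ := exists_forall_abs_cnt_sub_le hQ k hη0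
  obtain ⟨L₂, hL₂⟩ := exists_forall_abs_cnt_sub_le hQ (k + m) hη0
  set L := max (max L₁ L₂) 1 with hL
  have hLpos : 0 < L := by simp [hL]
  have hL1 := hL₁ L ((le_max_left _ _).trans (le_max_left _ _))
  have hL2 := hL₂ L ((le_max_right _ _).trans (le_max_left _ _))
  set C : ℝ := m * (n * (1 + 1)) + n * ℓ with hC
  have hC0 : 0 ≤ C := by positivity
  obtain ⟨R, hR, hgrowth⟩ := exists_card_eball_le n (C := C + n * L) (by positivity) hη0
  have hE : (0 : ℝ) < (eball n R).card := by exact_mod_cast card_eball_pos hR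
  have hr0 := rate_nonneg Q (k + m)
  have hr1 := (uDens_rate Q k).le_one
  have hr1' := (uDens_rate Q (k + m)).le_one
  -- the density of `gam Q 0 k` at the scale of the ball
  have hlow : ε / 2 * (eball n R).card ≤ cnt (gam Q 0 k) (eball n R) := by
    have h1 : ∀ z, (cnt (gam Q 0 k)ᶜ (box z L) : ℝ) ≤ (1 - (rate Q k - η)) * L ^ n := fun z => by
      have e1 : (cnt (gam Q 0 k) (box z L) : ℝ) + cnt (gam Q 0 k)ᶜ (box z L) = L ^ n := by
        have := cnt_add_cnt_compl (gam Q 0 k) (box z L)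
        rw [card_box] at this
        exact_mod_cast this
      linarith [(abs_le.mp (hL1 0 z)).1]
    have h2 := cnt_eball_le hLpos h1 R
    have h3 : (cnt (gam Q 0 k) (eball n R) : ℝ) + cnt (gam Q 0 k)ᶜ (eball n R) =
        (eball n R).card := by exact_mod_cast cnt_add_cnt_compl _ _
    have h4 : ((eball n (R + n * L)).card : ℝ) ≤ (eball n (R + (C + n * L))).card := by
      exact_mod_cast Finset.card_le_card (eball_mono (by linarith))
    have h5 := mul_le_mul_of_nonneg_left (h4.trans hgrowth)
      (show 0 ≤ 1 - (rate Q k - η) by linarith)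
    have h6 : (1 - (rate Q k - η)) * (1 + η) ≤ 1 - ε / 2 := by nlinarith
    nlinarith
  have hgr2 : ((eball n (R + n * ℓ)).card : ℝ) ≤ 2 * (eball n R).card := by
    have h4 : ((eball n (R + n * ℓ)).card : ℝ) ≤ (eball n (R + (C + n * L))).card := by
      refine Nat.cast_le.mpr (Finset.card_le_card (eball_mono ?_))
      have : (0 : ℝ) ≤ m * (n * (1 + 1)) := by positivity
      have : (0 : ℝ) ≤ n * L := by positivity
      linarith
    nlinarith
  obtain ⟨u, hu0, huℓ, S, hSR, hSΓ, hScard⟩ := exists_many_pairs hn hε hℓ hlow hgr2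
  have hum : ∑ i, u i ^ 2 ≤ m := by
    calc ∑ i, u i ^ 2 ≤ ∑ _i : Fin n, (ℓ : ℤ) ^ 2 := Finset.sum_le_sum fun i _ => by
          rw [← sq_abs]; exact pow_le_pow_left₀ (abs_nonneg _) (huℓ i) 2
      _ = m := by simp [hm]
  obtain ⟨θ, hθ0, hθ1, S', hS'S, hS'card, hmerge⟩ := exists_merge hc₀ hgap hN0 hNc m le_rfl k hum
    S id (· + u) fun x _ => rfl
  simp only [id_eq] at hmerge
  have hΓθ : gam Q θ k = gam Q 0 k := gam_congr Q hθ0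
  set G := (eball n (R + C)).filter (· ∈ gam Q 0 k) with hG
  have hS'G : S' ⊆ G := fun x hx => Finset.mem_filter.mpr
    ⟨eball_mono (by linarith) (hSR (hS'S hx)), (hSΓ x (hS'S hx)).1⟩
  have hS'u : ∀ x ∈ S', x + u ∈ G := fun x hx => by
    refine Finset.mem_filter.mpr ⟨mem_eball.mpr ?_, (hSΓ x (hS'S hx)).2⟩
    rw [castVec_add]
    refine (enrm_add_le _ _).trans ?_
    have e1 := mem_eball.mp (hSR (hS'S hx))
    have e2 := enrm_le_of_abs_le (v := castVec u) (M := ℓ) (by positivity) fun i => by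
      rw [castVec_apply]; exact_mod_cast huℓ i
    have : (0 : ℝ) ≤ m * (n * (1 + 1)) := by positivity
    linarith
  -- the points of `S'` are redundant
  have hcnt1 : cnt (gam Q θ (k + m)) (eball n R) + S'.card ≤ cnt (gam Q 0 k) (eball n (R + C)) := by
    have h1 : cnt (gam Q θ (k + m)) (eball n R) ≤ (G \ S').card := by
      refine Finset.card_le_card_of_surjOn (iterFrom Q θ m k) ?_
      intro y hy
      rw [Finset.coe_filter] at hy
      obtain ⟨hyR, hyΓ⟩ := hy
      rw [← iterFrom_image_gam, hΓθ] at hyΓ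
      obtain ⟨x, hx, rfl⟩ := hyΓ
      have hxG : x ∈ G := by
        refine Finset.mem_filter.mpr ⟨mem_eball.mpr ?_, hx⟩
        have e1 := enrm_le_enrm_iterFrom Q zero_le_one hθ1 m k x
        have e2 := mem_eball.mp hyR
        have : (0 : ℝ) ≤ n * ℓ := by positivity
        linarith
      obtain ⟨x', hx'G, hx'S, hx'⟩ := exists_notMem_of_merge hu0 hS'u hmerge hxG
      exact ⟨x', by simp [hx'G, hx'S], hx'⟩
    have h2 : (G \ S').card + S'.card = G.card := Finset.card_sdiff_add_card_eq_card hS'G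
    have h3 : G.card = cnt (gam Q 0 k) (eball n (R + C)) := by rw [hG, cnt]
    omega
  have hcnt2 : c₁ * (eball n R).card ≤ S'.card := by
    have h1 : (S.card : ℝ) ≤ (N ^ n) ^ m * S'.card := by exact_mod_cast hS'card
    have h2 : ε / 4 * (eball n R).card ≤ ((cube n ℓ).card * (N ^ n) ^ m) * (S'.card : ℝ) := by
      rw [mul_assoc]
      exact hScard.trans (mul_le_mul_of_nonneg_left h1 hcube.le)
    rw [hc₁, div_mul_eq_mul_div, div_le_iff₀ (by positivity)]
    linarith
  have hcnt3 : (cnt (gam Q θ (k + m)) (eball n R) : ℝ) + S'.card ≤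
      cnt (gam Q 0 k) (eball n (R + C)) := by exact_mod_cast hcnt1
  have hfinal := density_add_le (Γ := gam Q 0 k) (Γ' := gam Q θ (k + m)) hLpos
    (s := rate Q k + η) (t := rate Q (k + m) - η) (c := c₁) (C := C) (η := η) (R := R)
    (by linarith) (by linarith) hR
    (fun z => by linarith [(abs_le.mp (hL1 0 z)).2])
    (fun z => by linarith [(abs_le.mp (hL2 θ z)).1]) hC0 hgrowth (by linarith)
  nlinarith

/-- For a generic sequence, the rate of injectivity tends to `0`. -/
theorem exists_rate_lt (hn : 0 < n) {Q : OrthSeq n} (hQ : Q ∈ genericSet n) {ε : ℝ}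
    (hε : 0 < ε) : ∃ k, rate Q k < ε := by
  by_contra! h
  obtain ⟨m, c, hc, hdec⟩ := exists_rate_add_le hn hQ hε
  have h1 : ∀ j : ℕ, rate Q (j * m) ≤ 1 - j * c := by
    intro j
    induction j with
    | zero => simpa using (uDens_rate Q _).le_one
    | succ j ih =>
      have := hdec (j * m) (h _)
      rw [Nat.succ_mul]
      push_cast
      linarith
  obtain ⟨j, hj⟩ := exists_nat_gt (1 / c)
  rw [div_lt_iff₀ hc] at hj
  linarith [h1 j, rate_nonneg Q (j * m)]

theorem iInf_rate_lt {Q : OrthSeq n} {k : ℕ} {ε : ℝ} (h : rate Q k < ε) : ⨅ k, rate Q k < ε :=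
  (ciInf_le ⟨0, by rintro _ ⟨k, rfl⟩; exact rate_nonneg Q k⟩ k).trans_lt h

end DiscreteIsometry

theorem theorem1 (n : ℕ) (hn : 2 ≤ n) :
    (∃ G : Set (DiscreteIsometry.OrthSeq n), IsGδ G ∧ Dense G ∧
      ∀ P ∈ G, DiscreteIsometry.HasAsymptoticRate P 0) ∧
    (∀ ε : ℝ, 0 < ε → ∃ U : Set (DiscreteIsometry.OrthSeq n), IsOpen U ∧ Dense U ∧
      ∀ P ∈ U, ∃ t : ℝ, DiscreteIsometry.HasAsymptoticRate P t ∧ t < ε) := by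
  have hn0 : 0 < n := by omega
  refine ⟨⟨DiscreteIsometry.genericSet n, DiscreteIsometry.isGδ_genericSet n,
    DiscreteIsometry.dense_genericSet hn, fun P hP => ?_⟩, fun ε hε => ?_⟩
  · have h0 : ⨅ k, DiscreteIsometry.rate P k = 0 := by
      refine le_antisymm (le_of_forall_pos_le_add fun ε hε => ?_)
        (le_ciInf (DiscreteIsometry.rate_nonneg P))
      obtain ⟨k, hk⟩ := DiscreteIsometry.exists_rate_lt hn0 hP hε
      linarith [DiscreteIsometry.iInf_rate_lt hk]
    rw [← h0]
    exact DiscreteIsometry.hasAsymptoticRate_iInf P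
  · refine ⟨interior {P | ∃ k, DiscreteIsometry.rate P k < ε}, isOpen_interior, ?_, fun P hP => ?_⟩
    · refine (DiscreteIsometry.dense_genericSet hn).mono fun P hP => ?_
      obtain ⟨k, hk⟩ := DiscreteIsometry.exists_rate_lt hn0 hP hε
      obtain ⟨r, hr, h⟩ := DiscreteIsometry.exists_rate_lt_of_near hP hk
      rw [mem_interior_iff_mem_nhds, Metric.mem_nhds_iff]
      exact ⟨r, hr, fun Q hQ => ⟨k, h Q hQ⟩⟩
    · obtain ⟨k, hk⟩ := interior_subset hP
      exact ⟨_, DiscreteIsometry.hasAsymptoticRate_iInf P, DiscreteIsometry.iInf_rate_lt hk⟩
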